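/- All graphs and trigraphs are simple and finite. A trigraph is a triple $(V,B,R)$ with $B,R$ disjoint subsets of $\binom{V}{2}$ (black and red edges); a graph is a trigraph with $R=\emptyset$. Contracting two distinct (not necessarily adjacent) vertices $u,v$ of a trigraph replaces them by a single vertex $w$, where for every other vertex $x$: $wx$ is black if $ux$ and $vx$ are both black, $wx$ is a non-edge if neither $ux$ nor $vx$ is an edge, and $wx$ is red otherwise; all other pairs are unchanged. The twin-width $\mathrm{tww}(G)$ of a nonempty graph $G$ is the least $d$ for which $G$ can be reduced to a one-vertex graph by successive contractions such that in every trigraph of the sequence (including the first and the last) every vertex is incident with at most $d$ red edges. Theorem 5. Let $p:\mathbb{N}\to[0,1]$, and let $G=G(n,p(n))$ be the Erdős–Rényi random graph on $n$ labelled vertices, in which each pair of distinct vertices is independently adjacent with probability $p(n)$. Then the following hold. 1. If $p=o(n^{-4/3})$, then $\Pr[\mathrm{tww}(G)=0]\to 1$ as $n\to\infty$. 2. If $p=\omega(n^{-4/3})$ and $p=o(n^{-7/6})$, then $\Pr[\mathrm{tww}(G)=1]\to 1$ as $n\to\infty$. 3. If $p=\omega(n^{-7/6})$ and there is a constant $c\in(0,1)$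 such that $p(n)\le c/n$ for all sufficiently large $n$, then $\Pr[\mathrm{tww}(G)=2]\to 1$ as $n\to\infty$. -/

import Mathlib

open Filter Topology Asymptotics

/-- A finite trigraph `(verts, B, R)`, with vertices taken from an ambient type `V`: the black and
the red edges are two disjoint sets of 2-element subsets of `verts`. -/
structure Trigraph (V : Type*) where
  verts : Finset V
  black : SimpleGraph V
  red : SimpleGraph V
  black_mem : ∀ x y, black.Adj x y → x ∈ verts
  red_mem : ∀ x y, red.Adj x y → x ∈ verts
  disjoint : ∀ x y, black.Adj x y → ¬ red.Adj x y

namespace Trigraph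

variable {V : Type*}

/-- `xy` is an edge, black or red. -/
def IsEdge (G : Trigraph V) (x y : V) : Prop := G.black.Adj x y ∨ G.red.Adj x y

/-- The number of red edges incident with `x`. -/
noncomputable def redDegree (G : Trigraph V) (x : V) : ℕ := (G.red.neighborSet x).ncard

/-- The maximum red-degree of a vertex. -/
noncomputable def maxRedDegree (G : Trigraph V) : ℕ := G.verts.sup G.redDegree

/-- A graph, viewed as a trigraph without red edges. -/
def ofGraph [Fintype V] (G : SimpleGraph V) : Trigraph V where
  verts := Finset.univ
  black := G
  red := ⊥
  black_mem := fun x _ _ => Finset.mem_univ x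
  red_mem := fun x _ _ => Finset.mem_univ x
  disjoint := fun _ _ _ h => h

/-- `wx` is to be a black edge of `G/{u,v}`, for the new vertex `w`. -/
def NewBlack (G : Trigraph V) (u v x : V) : Prop := G.black.Adj u x ∧ G.black.Adj v x

/-- `wx` is to be a nonedge of `G/{u,v}`, for the new vertex `w`. -/
def NewNonedge (G : Trigraph V) (u v x : V) : Prop := ¬ G.IsEdge u x ∧ ¬ G.IsEdge v x

/-- `wx` is to be a red edge of `G/{u,v}`, for the new vertex `w`. -/
def NewRed (G : Trigraph V) (u v x : V) : Prop := ¬ G.NewBlack u v x ∧ ¬ G.NewNonedge u v x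

/-- The trigraph `G/{u,v}` obtained by contracting the distinct vertices `u` and `v`; the new
vertex `w` is called `u` again. -/
def contract [DecidableEq V] (G : Trigraph V) (u v : V) : Trigraph V where
  verts := insert u (G.verts \ {u, v})
  black :=
    { Adj := fun x y => x ≠ y ∧ x ≠ v ∧ y ≠ v ∧
        if x = u then G.NewBlack u v y
        else if y = u then G.NewBlack u v x
        else G.black.Adj x y
      symm := ⟨by
        rintro x y ⟨hxy, hx, hy, h⟩
        refine ⟨hxy.symm, hy, hx, ?_⟩
        have := G.black.adj_comm x y
        split_ifs at h ⊢ <;> simp_all⟩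
      loopless := ⟨fun x h => h.1 rfl⟩ }
  red :=
    { Adj := fun x y => x ≠ y ∧ x ≠ v ∧ y ≠ v ∧
        if x = u then G.NewRed u v y
        else if y = u then G.NewRed u v x
        else G.red.Adj x y
      symm := ⟨by
        rintro x y ⟨hxy, hx, hy, h⟩
        refine ⟨hxy.symm, hy, hx, ?_⟩
        have := G.red.adj_comm x y
        split_ifs at h ⊢ <;> simp_all⟩
      loopless := ⟨fun x h => h.1 rfl⟩ }
  black_mem := by
    rintro x y ⟨hxy, hx, hy, h⟩
    have h1 := fun a => G.black_mem x a
    have h2 := G.black.adj_comm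
    by_cases hxu : x = u
    · simp [hxu]
    · simp only [hxu, if_false] at h
      have : x ∈ G.verts := by
        split_ifs at h
        · exact h1 _ h.1.symm
        · exact h1 _ h
      simp [hxu, hx, this]
  red_mem := by
    rintro x y ⟨hxy, hx, hy, h⟩
    by_cases hxu : x = u
    · simp [hxu]
    · simp only [hxu, if_false] at h
      have : x ∈ G.verts := by
        by_contra hn
        have hb : ∀ a, ¬ G.black.Adj a x := fun a ha => hn (G.black_mem x a ha.symm)
        have hr : ∀ a, ¬ G.red.Adj a x := fun a ha => hn (G.red_mem x a ha.symm)
        split_ifs at h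
        · exact h.2 ⟨by simp [IsEdge, hb, hr], by simp [IsEdge, hb, hr]⟩
        · exact hr _ h.symm
      simp [hxu, hx, this]
  disjoint := by
    rintro x y ⟨-, -, -, h⟩ ⟨-, -, -, h'⟩
    split_ifs at h h'
    · exact h'.1 h
    · exact h'.1 h
    · exact G.disjoint _ _ h h'

/-- `H` is obtained from `G` by contracting two distinct vertices. -/
def Contracts [DecidableEq V] (G H : Trigraph V) : Prop :=
  ∃ u ∈ G.verts, ∃ v ∈ G.verts, u ≠ v ∧ H = G.contract u v

/-- `G` admits a `d`-contraction sequence: trigraphs `s 0 = G, s 1, …, s t`, each obtained from the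
previous one by a contraction, all of maximum red-degree at most `d`, the last one having a single
vertex. -/
def HasContractionSequence [DecidableEq V] (G : Trigraph V) (d : ℕ) : Prop :=
  ∃ (t : ℕ) (s : Fin (t + 1) → Trigraph V),
    s 0 = G ∧
    (∀ i : Fin t, (s i.castSucc).Contracts (s i.succ)) ∧
    (s (Fin.last t)).verts.card = 1 ∧
    ∀ i, (s i).maxRedDegree ≤ d

/-- Every trigraph with at least one vertex admits a contraction sequence. -/
theorem exists_hasContractionSequence [DecidableEq V] (G : Trigraph V) (h : G.verts.Nonempty) :
    ∃ d, G.HasContractionSequence d := by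
  induction hn : G.verts.card using Nat.strong_induction_on generalizing G with
  | _ n ih =>
    rcases Nat.lt_or_ge 1 n with h1 | h1
    · obtain ⟨u, hu, v, hv, huv⟩ := Finset.one_lt_card.1 (hn ▸ h1)
      have hlt : (G.contract u v).verts.card < n := by
        rw [← hn]
        refine Finset.card_lt_card ⟨fun x hx => ?_, fun hs => ?_⟩
        · simp only [contract, Finset.mem_insert, Finset.mem_sdiff] at hx
          rcases hx with rfl | hx
          · exact hu
          · exact hx.1
        · have := hs hv
          simp [contract, huv.symm] at this
      obtain ⟨d, t, s, h0, hs, hl, hd⟩ := ih _ hlt (G.contract u v) ⟨u, by simp [contract]⟩ rfl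
      refine ⟨max d G.maxRedDegree, t + 1, Fin.cons G s, rfl, ?_, ?_, ?_⟩
      · intro i
        refine Fin.cases ?_ (fun j => ?_) i
        · exact ⟨u, hu, v, hv, huv, by simpa using h0⟩
        · simpa using hs j
      · simpa [← Fin.succ_last] using hl
      · intro i
        refine Fin.cases ?_ (fun j => ?_) i
        · simp
        · simpa using Or.inl (hd j)
    · have : G.verts.card = 1 := by
        have := h.card_pos
        omega
      exact ⟨G.maxRedDegree, 0, fun _ => G, rfl, fun i => i.elim0, this, fun _ => le_rfl⟩

end Trigraph

/-- The twin-width of a (nonempty finite) graph: the minimum `d` such that the graph admits a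
`d`-contraction sequence. -/
noncomputable def twinWidth {V : Type*} [Fintype V] [DecidableEq V] (G : SimpleGraph V) : ℕ :=
  sInf {d : ℕ | (Trigraph.ofGraph G).HasContractionSequence d}

/-- The minimum in the definition of twin-width is attained. -/
theorem isLeast_twinWidth {V : Type*} [Fintype V] [DecidableEq V] [Nonempty V]
    (G : SimpleGraph V) :
    IsLeast {d : ℕ | (Trigraph.ofGraph G).HasContractionSequence d} (twinWidth G) :=
  ⟨Nat.sInf_mem ((Trigraph.ofGraph G).exists_hasContractionSequence Finset.univ_nonempty),
    fun _ h => Nat.sInf_le h⟩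

/-- The Erdős–Rényi random graph `G(n, p n)`, on the vertex set `Fin n`, satisfies `A`
asymptotically almost surely. -/
def AlmostSurelyAsymptotically (p : ℕ → unitInterval)
    (A : ∀ n : ℕ, SimpleGraph (Fin n) → Prop) : Prop :=
  Tendsto (fun n : ℕ => SimpleGraph.binomialRandom (Fin n) (p n) {G | A n G}) atTop (𝓝 1)

/-!
Twin-width is monotone under induced subgraphs, so a lower bound follows from an induced copy of a
small tree, and the upper bounds come from the excluded subgraphs of sparse random graphs.

*Lower bounds.* Contracting vertices of a host trigraph either leaves an induced pattern in place, up
to additional red edges, or contracts the pattern itself (`Trigraph.WeaklyContains.contract`). Hence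
it is enough that the path on four vertices has twin-width at least one and that the spider with
three legs of length two has twin-width at least two, two finite checks. A tree with `m` edges
occurs as an induced subgraph with high probability once `n ^ (m + 1) * p ^ m → ∞` and `p → 0`
(`almostSurely_exists_induced_copy`): by the second moment method the number of copies is at least
half its mean, whereas by Markov's inequality few copies have a further edge. The thresholds are
`n ^ (-4 / 3)` for the path and `n ^ (-7 / 6)` for the spider.

*Upper bounds.* Below the first threshold no path on four vertices occurs, and such graphs
reduce along twins without red edges. Below the second threshold there are neither cycles nor
spiders: the graph is a forest of caterpillars, each of which is contracted from one end of its
spine to the other, with a single red edge at any time. For `p ≤ c / n` with `c < 1` no path has two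
distinct chords at its two ends, since the expected number of such configurations is at most
`p * ∑ k, (k + 1) ^ 2 * c ^ (k + 1)`. Consequently every component has at most one cycle
(`NoBicycle.hasFrame`). Such a pseudoforest is a rooted forest in which a root `r` may have an
additional edge to a vertex `b` below it. The branch containing `b` is contracted first, from the
leaves upwards, leaving the rest of the component untouched: the vertex carrying the additional edge
climbs towards `r` until that edge becomes an edge of the tree. The remaining forest is then
contracted from the leaves in the same way, and red degrees never exceed two
(`Trigraph.Framed.hasContractionSequence_two`).
-/

/-! ### Contraction sequences -/

namespace Trigraph

section Basic

variable {V : Type*}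

theorem isEdge_comm (G : Trigraph V) (x y : V) : G.IsEdge x y ↔ G.IsEdge y x := by
  simp [IsEdge, G.black.adj_comm x y, G.red.adj_comm x y]

theorem IsEdge.mem_left {G : Trigraph V} {x y : V} (h : G.IsEdge x y) : x ∈ G.verts :=
  h.elim (G.black_mem _ _) (G.red_mem _ _)

theorem IsEdge.mem_right {G : Trigraph V} {x y : V} (h : G.IsEdge x y) : y ∈ G.verts :=
  ((G.isEdge_comm _ _).1 h).mem_left

theorem IsEdge.ne {G : Trigraph V} {x y : V} (h : G.IsEdge x y) : x ≠ y :=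
  h.elim (·.ne) (·.ne)

theorem maxRedDegree_le_iff {G : Trigraph V} {d : ℕ} :
    G.maxRedDegree ≤ d ↔ ∀ x ∈ G.verts, (G.red.neighborSet x).ncard ≤ d := by
  simp [maxRedDegree, redDegree]

theorem finite_neighborSet (G : Trigraph V) (x : V) : (G.red.neighborSet x).Finite :=
  G.verts.finite_toSet.subset fun _ hy => G.red_mem _ _ (SimpleGraph.Adj.symm hy)

theorem maxRedDegree_eq_zero {G : Trigraph V} (h : ∀ x y, ¬ G.red.Adj x y) :
    G.maxRedDegree ≤ 0 := by
  rw [maxRedDegree_le_iff]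
  intro x _
  have : G.red.neighborSet x = ∅ := Set.eq_empty_iff_forall_notMem.2 fun y hy => h x y hy
  simp [this]

theorem not_red_of_maxRedDegree_le_zero {G : Trigraph V} (h : G.maxRedDegree ≤ 0) (x y : V) :
    ¬ G.red.Adj x y := by
  intro hxy
  have h1 := maxRedDegree_le_iff.1 h x (G.red_mem _ _ hxy)
  have h2 : (G.red.neighborSet x) = ∅ := by
    simpa [Set.ncard_eq_zero (G.finite_neighborSet x)] using h1
  exact (Set.eq_empty_iff_forall_notMem.1 h2) y hxy

theorem red_unique_of_maxRedDegree_le_one {G : Trigraph V} (h : G.maxRedDegree ≤ 1) {x y z : V}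
    (hy : G.red.Adj x y) (hz : G.red.Adj x z) : y = z :=
  (Set.ncard_le_one (G.finite_neighborSet x)).1
    (maxRedDegree_le_iff.1 h x (G.red_mem _ _ hy)) y hy z hz

theorem maxRedDegree_le_one {G : Trigraph V} (h : ∀ x y z, G.red.Adj x y → G.red.Adj x z → y = z) :
    G.maxRedDegree ≤ 1 :=
  maxRedDegree_le_iff.2 fun x _ =>
    (Set.ncard_le_one (G.finite_neighborSet x)).2 fun y hy z hz => h x y z hy hz

theorem maxRedDegree_le_two {G : Trigraph V}
    (h : ∀ x, ∃ a b, ∀ y, G.red.Adj x y → y = a ∨ y = b) : G.maxRedDegree ≤ 2 := by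
  refine maxRedDegree_le_iff.2 fun x _ => ?_
  obtain ⟨a, b, hab⟩ := h x
  exact (Set.ncard_le_ncard (t := {a, b}) (fun y hy => hab y hy) (by simp)).trans
    ((Set.ncard_insert_le a {b}).trans (by simp))

end Basic

variable {V : Type*} [DecidableEq V]

theorem HasContractionSequence.mono {G : Trigraph V} {d e : ℕ} (h : G.HasContractionSequence d)
    (hde : d ≤ e) : G.HasContractionSequence e := by
  obtain ⟨t, s, h0, hs, hl, hd⟩ := h
  exact ⟨t, s, h0, hs, hl, fun i => (hd i).trans hde⟩

theorem hasContractionSequence_of_card_eq_one {G : Trigraph V} {d : ℕ} (h : G.verts.card = 1)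
    (hd : G.maxRedDegree ≤ d) : G.HasContractionSequence d :=
  ⟨0, fun _ => G, rfl, fun i => i.elim0, h, fun _ => hd⟩

theorem HasContractionSequence.cons {G H : Trigraph V} {d : ℕ} (hH : H.HasContractionSequence d)
    (hGH : G.Contracts H) (hd : G.maxRedDegree ≤ d) : G.HasContractionSequence d := by
  obtain ⟨t, s, h0, hs, hl, hsd⟩ := hH
  refine ⟨t + 1, Fin.cons G s, rfl, ?_, ?_, ?_⟩
  · intro i
    refine Fin.cases ?_ (fun j => ?_) i
    · simpa [h0] using hGH
    · simpa using hs j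
  · simpa [← Fin.succ_last] using hl
  · intro i
    refine Fin.cases ?_ (fun j => ?_) i
    · simpa using hd
    · simpa using hsd j

/-- Induction along a contraction sequence, from its last trigraph to its first one. -/
theorem HasContractionSequence.induct {d : ℕ} {motive : Trigraph V → Prop}
    (single : ∀ G, G.verts.card = 1 → G.maxRedDegree ≤ d → motive G)
    (step : ∀ G H, G.Contracts H → G.maxRedDegree ≤ d → H.maxRedDegree ≤ d →
      H.HasContractionSequence d → motive H → motive G)
    {G : Trigraph V} (h : G.HasContractionSequence d) : motive G := by
  obtain ⟨t, s, h0, hs, hl, hd⟩ := h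
  induction t generalizing G with
  | zero => exact single _ (h0 ▸ hl) (h0 ▸ hd 0)
  | succ t ih =>
    have hs' : ∀ i : Fin t, (s i.castSucc.succ).Contracts (s i.succ.succ) := fun i => by
      simpa using hs i.succ
    have hl' : (s (Fin.last t).succ).verts.card = 1 := by simpa [Fin.succ_last] using hl
    subst h0
    exact step _ (s (Fin.succ 0)) (by simpa using hs 0) (hd 0) (hd _)
      ⟨t, fun i => s i.succ, rfl, hs', hl', fun i => hd _⟩
      (ih (fun i => s i.succ) rfl hs' hl' fun i => hd _)

theorem verts_contract {G : Trigraph V} {u v : V} (hu : u ∈ G.verts) (huv : u ≠ v) :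
    (G.contract u v).verts = G.verts.erase v := by
  ext x
  simp only [contract, Finset.mem_insert, Finset.mem_sdiff, Finset.mem_singleton,
    Finset.mem_erase]
  by_cases hx : x = u
  · subst hx; simp [hu, huv]
  · by_cases hv : x = v <;> simp [hx, hv, huv.symm]

/-- A red edge of a contraction is an old red edge or joins the new vertex to an old neighbour of
one of the two contracted vertices. -/
theorem red_contract {G : Trigraph V} {u v x y : V} (h : (G.contract u v).red.Adj x y) :
    x ≠ y ∧ x ≠ v ∧ y ≠ v ∧ ((x ≠ u ∧ y ≠ u ∧ G.red.Adj x y) ∨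
      (x = u ∧ (G.IsEdge u y ∨ G.IsEdge v y)) ∨ (y = u ∧ (G.IsEdge u x ∨ G.IsEdge v x))) := by
  obtain ⟨h1, h2, h3, h4⟩ := h
  refine ⟨h1, h2, h3, ?_⟩
  split_ifs at h4 with hx hy
  · have := h4.2
    exact Or.inr (Or.inl ⟨hx, by by_contra! hn; exact this hn⟩)
  · have := h4.2
    exact Or.inr (Or.inr ⟨hy, by by_contra! hn; exact this hn⟩)
  · exact Or.inl ⟨hx, hy, h4⟩

theorem isEdge_contract {G : Trigraph V} {u v x y : V} (h : (G.contract u v).IsEdge x y) :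
    x ≠ y ∧ x ≠ v ∧ y ≠ v ∧ ((x ≠ u ∧ y ≠ u ∧ G.IsEdge x y) ∨
      (x = u ∧ (G.IsEdge u y ∨ G.IsEdge v y)) ∨ (y = u ∧ (G.IsEdge u x ∨ G.IsEdge v x))) := by
  rcases h with h | h
  · obtain ⟨h1, h2, h3, h4⟩ := h
    refine ⟨h1, h2, h3, ?_⟩
    split_ifs at h4 with hx hy
    · exact Or.inr (Or.inl ⟨hx, Or.inl (Or.inl h4.1)⟩)
    · exact Or.inr (Or.inr ⟨hy, Or.inl (Or.inl h4.1)⟩)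
    · exact Or.inl ⟨hx, hy, Or.inl h4⟩
  · obtain ⟨h1, h2, h3, h4⟩ := red_contract h
    refine ⟨h1, h2, h3, ?_⟩
    rcases h4 with h4 | h4 | h4
    · exact Or.inl ⟨h4.1, h4.2.1, Or.inr h4.2.2⟩
    · exact Or.inr (Or.inl h4)
    · exact Or.inr (Or.inr h4)

/-! ### Monotonicity of twin-width -/

section WeaklyContains

variable {V W : Type*}

/-- `H` contains an induced copy of `P`, up to turning black edges and nonedges of the copy red.
Such a copy has at least the red edges of `P`, and contractions preserve the relation. -/
structure WeaklyContains (H : Trigraph V) (P : Trigraph W) (f : W → V) : Prop where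
  mem : ∀ i ∈ P.verts, f i ∈ H.verts
  inj : ∀ i ∈ P.verts, ∀ j ∈ P.verts, f i = f j → i = j
  red : ∀ i j, P.red.Adj i j → H.red.Adj (f i) (f j)
  edge : ∀ i j, P.black.Adj i j → H.IsEdge (f i) (f j)
  nonedge : ∀ i ∈ P.verts, ∀ j ∈ P.verts, i ≠ j → ¬ P.IsEdge i j → ¬ H.black.Adj (f i) (f j)

theorem WeaklyContains.maxRedDegree_le {H : Trigraph V} {P : Trigraph W} {f : W → V}
    (h : WeaklyContains H P f) : P.maxRedDegree ≤ H.maxRedDegree := by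
  refine maxRedDegree_le_iff.2 fun i hi => ?_
  refine le_trans ?_ (maxRedDegree_le_iff.1 le_rfl (f i) (h.mem i hi))
  refine Set.ncard_le_ncard_of_injOn f (fun j hj => h.red _ _ hj) ?_ (H.finite_neighborSet _)
  intro j hj k hk hjk
  exact h.inj j (P.red_mem _ _ (SimpleGraph.Adj.symm hj)) k
    (P.red_mem _ _ (SimpleGraph.Adj.symm hk)) hjk

theorem WeaklyContains.isEdge {H : Trigraph V} {P : Trigraph W} {f : W → V}
    (h : WeaklyContains H P f) {i j : W} (hij : P.IsEdge i j) : H.IsEdge (f i) (f j) :=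
  hij.elim (h.edge i j) fun hr => Or.inr (h.red i j hr)

end WeaklyContains

theorem red_contract_map {G : Trigraph V} {u v x y : V} (huv : u ≠ v) (h : G.red.Adj x y)
    (hne : (if x = v then u else x) ≠ if y = v then u else y) :
    (G.contract u v).red.Adj (if x = v then u else x) (if y = v then u else y) := by
  have hb : ¬ G.black.Adj x y := fun hb => G.disjoint _ _ hb h
  have h' := h.symm
  have hb' : ¬ G.black.Adj y x := fun hb => G.disjoint _ _ hb h'
  have hxy := h.ne
  refine ⟨hne, by split_ifs <;> assumption, by split_ifs <;> assumption, ?_⟩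
  by_cases hx : x = v <;> by_cases hy : y = v <;>
    by_cases hxu : x = u <;> by_cases hyu : y = u <;>
    simp_all [NewRed, NewBlack, NewNonedge, IsEdge]

theorem isEdge_contract_map {G : Trigraph V} {u v x y : V} (huv : u ≠ v) (h : G.IsEdge x y)
    (hne : (if x = v then u else x) ≠ if y = v then u else y) :
    (G.contract u v).IsEdge (if x = v then u else x) (if y = v then u else y) := by
  by_contra hcon
  have key : ∀ a b, G.IsEdge a b ∨ G.IsEdge b a → NewNonedge G u v b →
      ¬ (a = u ∨ a = v) := by
    rintro a b hab ⟨h1, h2⟩ (rfl | rfl)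
    · exact h1 (hab.elim id (G.isEdge_comm _ _).1)
    · exact h2 (hab.elim id (G.isEdge_comm _ _).1)
  have h1 : ¬ (G.contract u v).black.Adj _ _ := fun h => hcon (Or.inl h)
  have h2 : ¬ (G.contract u v).red.Adj _ _ := fun h => hcon (Or.inr h)
  have k1 := key x y (Or.inl h)
  have k2 := key y x (Or.inr h)
  have e1 : (if x = v then u else x) ≠ v := by split_ifs <;> assumption
  have e2 : (if y = v then u else y) ≠ v := by split_ifs <;> assumption
  simp only [contract, not_and] at h1 h2
  replace h1 := h1 hne e1 e2
  replace h2 := h2 hne e1 e2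
  have hxy := h.ne
  by_cases hx : x = v <;> by_cases hy : y = v <;>
    by_cases hxu : x = u <;> by_cases hyu : y = u <;>
    simp_all [NewRed] <;> simp_all [IsEdge]

theorem not_black_contract_map {G : Trigraph V} {u v x y : V} (h : ¬ G.black.Adj x y) :
    ¬ (G.contract u v).black.Adj (if x = v then u else x) (if y = v then u else y) := by
  rintro ⟨h1, h2, h3, h4⟩
  have := G.black.adj_comm x y
  by_cases hx : x = v <;> by_cases hy : y = v <;>
    by_cases hxu : x = u <;> by_cases hyu : y = u <;>
    simp_all [NewBlack]

theorem red_contract_of {G : Trigraph V} {u v y : V} (huv : u ≠ v) (hyu : y ≠ u) (hyv : y ≠ v)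
    (h1 : ¬ G.NewBlack u v y) (h2 : ¬ G.NewNonedge u v y) : (G.contract u v).red.Adj u y :=
  ⟨hyu.symm, huv, hyv, by simpa using ⟨h1, h2⟩⟩

variable {W : Type*} [DecidableEq W]

/-- A contraction of a host trigraph either leaves a weakly contained pattern in place or contracts
it. -/
theorem WeaklyContains.contract {H : Trigraph V} {P : Trigraph W} {f : W → V}
    (h : WeaklyContains H P f) {u v : V} (hu : u ∈ H.verts) (huv : u ≠ v) :
    ∃ g, WeaklyContains (H.contract u v) P g ∨
      ∃ i ∈ P.verts, ∃ j ∈ P.verts, i ≠ j ∧ WeaklyContains (H.contract u v) (P.contract i j) g := by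
  refine ⟨fun i => if f i = v then u else f i, ?_⟩
  by_cases hc : ∃ i ∈ P.verts, f i = u ∧ ∃ j ∈ P.verts, f j = v
  · obtain ⟨i, hi, rfl, j, hj, rfl⟩ := hc
    have hij : i ≠ j := fun e => huv (by rw [e])
    refine Or.inr ⟨i, hi, j, hj, hij, ?_⟩
    have hv : ∀ k ∈ (P.contract i j).verts, k ∈ P.verts ∧ k ≠ j := fun k hk => by
      rw [verts_contract hi hij, Finset.mem_erase] at hk
      exact ⟨hk.2, hk.1⟩
    have hfj : ∀ k ∈ P.verts, k ≠ j → f k ≠ f j := fun k hk hkj e => hkj (h.inj k hk j hj e)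
    have hfi : ∀ k ∈ P.verts, k ≠ i → f k ≠ f i := fun k hk hkj e => hkj (h.inj k hk i hi e)
    have hval : ∀ k ∈ P.verts, k ≠ j → (if f k = f j then f i else f k) = f k :=
      fun k hk hkj => if_neg (hfj k hk hkj)
    have hne : ∀ k l, k ∈ P.verts → l ∈ P.verts → k ≠ l → f k ≠ f l :=
      fun k l hk hl hkl e => hkl (h.inj k hk l hl e)
    refine ⟨?_, ?_, ?_, ?_, ?_⟩
    · intro k hk
      obtain ⟨hk, hkj⟩ := hv k hk
      rw [hval k hk hkj, verts_contract hu huv, Finset.mem_erase]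
      exact ⟨hfj k hk hkj, h.mem k hk⟩
    · intro k hk l hl
      obtain ⟨hk, hkj⟩ := hv k hk
      obtain ⟨hl, hlj⟩ := hv l hl
      rw [hval k hk hkj, hval l hl hlj]
      exact h.inj k hk l hl
    · have key : ∀ l ∈ P.verts, l ≠ i → l ≠ j → P.NewRed i j l →
          (H.contract (f i) (f j)).red.Adj (f i) (f l) := by
        intro l hl hli hlj hred
        refine red_contract_of huv (hfi l hl hli) (hfj l hl hlj) ?_ ?_
        · rintro ⟨h1, h2⟩
          have hr1 : ¬ P.red.Adj i l := fun hr => H.disjoint _ _ h1 (h.red _ _ hr)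
          have hr2 : ¬ P.red.Adj j l := fun hr => H.disjoint _ _ h2 (h.red _ _ hr)
          have b1 : P.IsEdge i l := by
            by_contra hn; exact h.nonedge i hi l hl hli.symm hn h1
          have b2 : P.IsEdge j l := by
            by_contra hn; exact h.nonedge j hj l hl hlj.symm hn h2
          exact hred.1 ⟨b1.resolve_right hr1, b2.resolve_right hr2⟩
        · rintro ⟨h1, h2⟩
          exact hred.2 ⟨fun e => h1 (h.isEdge e), fun e => h2 (h.isEdge e)⟩
      intro k l hkl
      obtain ⟨hk, hkj⟩ := hv k ((P.contract i j).red_mem _ _ hkl)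
      obtain ⟨hl, hlj⟩ := hv l ((P.contract i j).red_mem _ _ hkl.symm)
      rw [hval k hk hkj, hval l hl hlj]
      obtain ⟨hkl, -, -, h4⟩ := hkl
      split_ifs at h4 with hki hli
      · subst hki
        exact key l hl hkl.symm hlj h4
      · subst hli
        exact (key k hk hkl hkj h4).symm
      · have := red_contract_map (u := f i) huv (h.red _ _ h4)
        rw [hval k hk hkj, hval l hl hlj] at this
        exact this (hne k l hk hl hkl)
    · intro k l hkl
      obtain ⟨hk, hkj⟩ := hv k ((P.contract i j).black_mem _ _ hkl)
      obtain ⟨hl, hlj⟩ := hv l ((P.contract i j).black_mem _ _ hkl.symm)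
      have key : P.IsEdge k l := by
        obtain ⟨hkl, -, -, h4⟩ := hkl
        split_ifs at h4 with hki hli
        · subst hki; exact Or.inl h4.1
        · subst hli; exact Or.inl h4.1.symm
        · exact Or.inl h4
      have := isEdge_contract_map (u := f i) huv (h.isEdge key)
      rw [hval k hk hkj, hval l hl hlj] at this ⊢
      exact this (hne k l hk hl key.ne)
    · intro k hk l hl hkl hn
      replace ⟨hk, hkj⟩ := hv k hk
      replace ⟨hl, hlj⟩ := hv l hl
      have lift : ∀ a b, (if a = j then i else a) = k → (if b = j then i else b) = l →
          ¬ P.IsEdge a b := by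
        rintro a b rfl rfl hab
        exact hn (isEdge_contract_map hij hab hkl)
      rcases em (k = i ∨ l = i) with hkl' | hkl'
      · rintro ⟨-, -, -, h4⟩
        simp only [hval k hk hkj, hval l hl hlj] at h4
        rcases hkl' with rfl | rfl
        · rw [if_pos rfl] at h4
          exact h.nonedge _ hi l hl hkl (lift k l (by simp [hkj]) (by simp [hlj])) h4.1
        · rw [if_neg (hfi k hk hkl), if_pos rfl] at h4
          exact h.nonedge _ hi k hk hkl.symm
            (fun e => lift k l (by simp [hkj]) (by simp [hlj]) ((P.isEdge_comm _ _).1 e)) h4.1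
      · exact not_black_contract_map
          (h.nonedge k hk l hl hkl (lift k l (by simp [hkj]) (by simp [hlj])))
  · left
    have hinj : ∀ k ∈ P.verts, ∀ l ∈ P.verts,
        (if f k = v then u else f k) = (if f l = v then u else f l) → k = l := by
      intro k hk l hl hkl
      by_cases h1 : f k = v <;> by_cases h2 : f l = v <;> simp only [h1, h2, if_true, if_false] at hkl
      · exact h.inj k hk l hl (h1.trans h2.symm)
      · exact (hc ⟨l, hl, hkl.symm, k, hk, h1⟩).elim
      · exact (hc ⟨k, hk, hkl, l, hl, h2⟩).elim
      · exact h.inj k hk l hl hkl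
    refine ⟨?_, hinj, ?_, ?_, ?_⟩
    · intro k hk
      rw [verts_contract hu huv, Finset.mem_erase]
      split_ifs with hkv
      · exact ⟨huv, hu⟩
      · exact ⟨hkv, h.mem k hk⟩
    · intro k l hkl
      exact red_contract_map huv (h.red _ _ hkl) fun e => hkl.ne
        (hinj k (P.red_mem _ _ hkl) l (P.red_mem _ _ hkl.symm) e)
    · intro k l hkl
      exact isEdge_contract_map huv (h.edge _ _ hkl) fun e => hkl.ne
        (hinj k (P.black_mem _ _ hkl) l (P.black_mem _ _ hkl.symm) e)
    · intro k hk l hl hkl hn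
      exact not_black_contract_map (h.nonedge k hk l hl hkl hn)

/-- Contraction sequences restrict to weakly contained trigraphs; in particular, twin-width does not
increase when passing to an induced subgraph. -/
theorem HasContractionSequence.of_weaklyContains {d : ℕ} {H : Trigraph V}
    (hH : H.HasContractionSequence d) {P : Trigraph W} {f : W → V} (hP : P.verts.Nonempty)
    (hf : WeaklyContains H P f) : P.HasContractionSequence d := by
  refine HasContractionSequence.induct (motive := fun H => ∀ (P : Trigraph W) (f : W → V),
    P.verts.Nonempty → WeaklyContains H P f → P.HasContractionSequence d) ?_ ?_ hH P f hP hf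
  · intro G hG hGd P f hP hf
    refine hasContractionSequence_of_card_eq_one (le_antisymm ?_ hP.card_pos)
      (hf.maxRedDegree_le.trans hGd)
    rw [← hG]
    exact Finset.card_le_card_of_injOn f hf.mem fun i hi j hj => hf.inj i hi j hj
  · intro G G' hGG' hG hG' _ ih P f hP hf
    obtain ⟨u, hu, v, hv, huv, rfl⟩ := hGG'
    obtain ⟨g, hg | ⟨i, hi, j, hj, hij, hg⟩⟩ := hf.contract hu huv
    · exact ih P g hP hg
    · exact (ih _ g ⟨i, by simp [verts_contract hi hij, hi, hij]⟩ hg).cons ⟨i, hi, j, hj, hij, rfl⟩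
        (hf.maxRedDegree_le.trans hG)

end Trigraph

/-! ### Two trees that force red edges -/

/-- The graph on `Fin k` joining every `i` to its parent `par i`; a vertex with `par i = i` has no
parent. -/
def parentGraph {k : ℕ} (par : Fin k → Fin k) : SimpleGraph (Fin k) where
  Adj i j := i ≠ j ∧ (par i = j ∨ par j = i)
  symm := ⟨fun _ _ h => ⟨h.1.symm, h.2.symm⟩⟩
  loopless := ⟨fun _ h => h.1 rfl⟩

instance {k : ℕ} (par : Fin k → Fin k) : DecidableRel (parentGraph par).Adj :=
  fun _ _ => inferInstanceAs (Decidable (_ ∧ _))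

/-- The parent function of the path on four vertices, rooted at an end. -/
abbrev pathParent : Fin 4 → Fin 4 := ![0, 0, 1, 2]

/-- The parent function of the spider with three legs of length two, rooted at its centre. -/
abbrev spiderParent : Fin 7 → Fin 7 := ![0, 0, 0, 0, 1, 2, 3]

namespace Trigraph

variable {V : Type*} [DecidableEq V]

theorem HasContractionSequence.maxRedDegree_le {G : Trigraph V} {d : ℕ}
    (h : G.HasContractionSequence d) : G.maxRedDegree ≤ d := by
  obtain ⟨t, s, h0, -, -, hd⟩ := h
  exact h0 ▸ hd 0

theorem HasContractionSequence.exists_contract {G : Trigraph V} {d : ℕ}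
    (h : G.HasContractionSequence d) (hG : G.verts.card ≠ 1) :
    ∃ u ∈ G.verts, ∃ v ∈ G.verts, u ≠ v ∧ (G.contract u v).HasContractionSequence d := by
  refine HasContractionSequence.induct (motive := fun G => G.verts.card ≠ 1 →
    ∃ u ∈ G.verts, ∃ v ∈ G.verts, u ≠ v ∧ (G.contract u v).HasContractionSequence d) ?_ ?_ h hG
  · exact fun G h _ h' => (h' h).elim
  · rintro G H ⟨u, hu, v, hv, huv, rfl⟩ - - hseq - -
    exact ⟨u, hu, v, hv, huv, hseq⟩

instance decidableRelBlackOfGraph [Fintype V] (G : SimpleGraph V) [DecidableRel G.Adj] :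
    DecidableRel (ofGraph G).black.Adj :=
  inferInstanceAs (DecidableRel G.Adj)

instance decidableRelRedOfGraph [Fintype V] (G : SimpleGraph V) :
    DecidableRel (ofGraph G).red.Adj :=
  fun _ _ => isFalse fun h => h

instance decidableRelBlackContract (G : Trigraph V) [DecidableRel G.black.Adj] (u v : V) :
    DecidableRel (G.contract u v).black.Adj := fun x y =>
  inferInstanceAs (Decidable (x ≠ y ∧ x ≠ v ∧ y ≠ v ∧
    if x = u then G.black.Adj u y ∧ G.black.Adj v y
    else if y = u then G.black.Adj u x ∧ G.black.Adj v x
    else G.black.Adj x y))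

instance decidableRelRedContract (G : Trigraph V) [DecidableRel G.black.Adj]
    [DecidableRel G.red.Adj] (u v : V) : DecidableRel (G.contract u v).red.Adj := fun x y =>
  inferInstanceAs (Decidable (x ≠ y ∧ x ≠ v ∧ y ≠ v ∧
    if x = u then ¬ (G.black.Adj u y ∧ G.black.Adj v y) ∧
      ¬ (¬ (G.black.Adj u y ∨ G.red.Adj u y) ∧ ¬ (G.black.Adj v y ∨ G.red.Adj v y))
    else if y = u then ¬ (G.black.Adj u x ∧ G.black.Adj v x) ∧
      ¬ (¬ (G.black.Adj u x ∨ G.red.Adj u x) ∧ ¬ (G.black.Adj v x ∨ G.red.Adj v x))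
    else G.red.Adj x y))

theorem not_hasContractionSequence_path :
    ¬ (ofGraph (parentGraph pathParent)).HasContractionSequence 0 := by
  intro h
  obtain ⟨u, -, v, -, huv, h⟩ := h.exists_contract (by simp [ofGraph])
  have key : ∀ u v : Fin 4, u ≠ v →
      ∃ x y, ((ofGraph (parentGraph pathParent)).contract u v).red.Adj x y := by
    decide +kernel
  obtain ⟨x, y, hxy⟩ := key u v huv
  exact not_red_of_maxRedDegree_le_zero h.maxRedDegree_le x y hxy

/-- The only contractions of the spider with maximum red degree at most one shorten a leg, and every
further contraction creates a vertex of red degree two. -/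
theorem not_hasContractionSequence_spider :
    ¬ (ofGraph (parentGraph spiderParent)).HasContractionSequence 1 := by
  intro h
  obtain ⟨u, hu, v, hv, huv, h⟩ := h.exists_contract (by simp [ofGraph])
  obtain ⟨u', hu', v', hv', huv', h'⟩ := h.exists_contract (by
    rw [verts_contract hu huv, Finset.card_erase_of_mem hv]; simp [ofGraph])
  rw [verts_contract hu huv, Finset.mem_erase] at hu' hv'
  have key : ∀ u v : Fin 7, u ≠ v →
      (∃ x y z, y ≠ z ∧ ((ofGraph (parentGraph spiderParent)).contract u v).red.Adj x y ∧
        ((ofGraph (parentGraph spiderParent)).contract u v).red.Adj x z) ∨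
      ∀ u' v' : Fin 7, u' ≠ v → v' ≠ v → u' ≠ v' →
        ∃ x y z, y ≠ z ∧
          (((ofGraph (parentGraph spiderParent)).contract u v).contract u' v').red.Adj x y ∧
          (((ofGraph (parentGraph spiderParent)).contract u v).contract u' v').red.Adj x z := by
    decide +kernel
  rcases key u v huv with ⟨x, y, z, hyz, hy, hz⟩ | hk
  · exact hyz (red_unique_of_maxRedDegree_le_one h.maxRedDegree_le hy hz)
  · obtain ⟨x, y, z, hyz, hy, hz⟩ := hk u' v' hu'.1 hv'.1 huv'
    exact hyz (red_unique_of_maxRedDegree_le_one h'.maxRedDegree_le hy hz)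

theorem weaklyContains_ofGraph {U W : Type*} [Fintype U] [Fintype W] {G : SimpleGraph U}
    {P : SimpleGraph W} {f : W → U} (hf : Function.Injective f)
    (h : ∀ i j, G.Adj (f i) (f j) ↔ P.Adj i j) : WeaklyContains (ofGraph G) (ofGraph P) f where
  mem := by simp [ofGraph]
  inj := fun _ _ _ _ h => hf h
  red := fun _ _ h => h.elim
  edge := fun i j hij => Or.inl ((h i j).2 hij)
  nonedge := fun i _ j _ _ hn hb => hn (Or.inl ((h i j).1 hb))

end Trigraph

/-! ### Excluded subgraphs -/

/-- The sequence `f` of vertices traces a path in `G`. -/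
structure IsPathSeq {V : Type*} (G : SimpleGraph V) {k : ℕ} (f : Fin k → V) : Prop where
  inj : Function.Injective f
  adj : ∀ i j : Fin k, (i : ℕ) + 1 = j → G.Adj (f i) (f j)

/-- `G` has no cycle: no path on at least three vertices has adjacent ends. -/
def CycleFree {V : Type*} (G : SimpleGraph V) : Prop :=
  ∀ (k : ℕ) (f : Fin (k + 3) → V), IsPathSeq G f → ¬ G.Adj (f 0) (f (Fin.last _))

/-- `G` contains no copy, induced or not, of the graph `P`. -/
def OmitsSubgraph {V W : Type*} (G : SimpleGraph V) (P : SimpleGraph W) : Prop :=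
  ∀ f : W → V, Function.Injective f → ¬ ∀ i j, P.Adj i j → G.Adj (f i) (f j)

section

variable {V : Type*} {G : SimpleGraph V}

theorem OmitsSubgraph.not_path (h : OmitsSubgraph G (parentGraph pathParent)) {a b c d : V}
    (hac : a ≠ c) (had : a ≠ d) (hbd : b ≠ d) (h1 : G.Adj a b) (h2 : G.Adj b c) (h3 : G.Adj c d) :
    False := by
  have := h1.ne; have := h2.ne; have := h3.ne
  have := h1.symm; have := h2.symm; have := h3.symm
  refine h ![a, b, c, d] ?_ ?_
  · intro i j hij
    fin_cases i <;> fin_cases j <;> simp_all [eq_comm]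
  · intro i j hij
    fin_cases i <;> fin_cases j <;> simp_all [parentGraph]

theorem OmitsSubgraph.not_spider (h : OmitsSubgraph G (parentGraph spiderParent))
    {y a b c a' b' c' : V} (hf : Function.Injective ![y, a, b, c, a', b', c'])
    (ha : G.Adj y a) (hb : G.Adj y b) (hc : G.Adj y c)
    (ha' : G.Adj a a') (hb' : G.Adj b b') (hc' : G.Adj c c') : False := by
  have := ha.symm; have := hb.symm; have := hc.symm
  have := ha'.symm; have := hb'.symm; have := hc'.symm
  refine h _ hf ?_
  intro i j hij
  fin_cases i <;> fin_cases j <;> first | (exfalso; revert hij; decide) | assumption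

theorem CycleFree.not_triangle (h : CycleFree G) {a b c : V} (h1 : G.Adj a b) (h2 : G.Adj b c)
    (h3 : G.Adj a c) : False := by
  have := h1.ne; have := h2.ne; have := h3.ne
  refine h 0 ![a, b, c] ⟨?_, ?_⟩ h3
  · intro i j hij
    fin_cases i <;> fin_cases j <;> simp_all [eq_comm]
  · intro i j hij
    fin_cases i <;> fin_cases j <;> simp_all

theorem CycleFree.not_square (h : CycleFree G) {a b c d : V} (hac : a ≠ c) (hbd : b ≠ d)
    (h1 : G.Adj a b) (h2 : G.Adj b c) (h3 : G.Adj c d) (h4 : G.Adj a d) : False := by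
  have := h1.ne; have := h2.ne; have := h3.ne; have := h4.ne
  refine h 1 ![a, b, c, d] ⟨?_, ?_⟩ h4
  · intro i j hij
    fin_cases i <;> fin_cases j <;> simp_all [eq_comm]
  · intro i j hij
    fin_cases i <;> fin_cases j <;> simp_all

end

/-! ### Contracting down to twin-width zero -/

namespace Trigraph

variable {V : Type*} [DecidableEq V]

/-- A trigraph without red edges whose black graph has no path on four vertices can be contracted
along pairs of twins. -/
theorem hasContractionSequence_zero {H : Trigraph V} (hH : H.verts.Nonempty)
    (hred : ∀ x y, ¬ H.red.Adj x y) (hP : OmitsSubgraph H.black (parentGraph pathParent)) :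
    H.HasContractionSequence 0 := by
  induction hn : H.verts.card generalizing H with
  | zero => exact (hH.card_ne_zero hn).elim
  | succ n ih =>
    by_cases hn0 : n = 0
    · exact hasContractionSequence_of_card_eq_one (by omega) (maxRedDegree_eq_zero hred)
    obtain ⟨u, hu, v, hv, huv, htw⟩ : ∃ u ∈ H.verts, ∃ v ∈ H.verts, u ≠ v ∧
        ∀ x, x ≠ u → x ≠ v → (H.black.Adj u x ↔ H.black.Adj v x) := by
      by_cases he : ∃ u v, H.black.Adj u v
      · obtain ⟨u, v, huv⟩ := he
        -- If `x` is adjacent to `u` and not to `v`, then `u` is the only neighbour of `x` and `v`.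
        have key : ∀ u v x, H.black.Adj u v → H.black.Adj u x → x ≠ v → ¬ H.black.Adj v x →
            ∀ y, y ≠ x → y ≠ v → (H.black.Adj x y ↔ H.black.Adj v y) := by
          intro u v x huv hux hxv hvx y hyx hyv
          by_cases hyu : y = u
          · subst hyu; exact ⟨fun _ => huv.symm, fun _ => hux.symm⟩
          · exact ⟨fun hxy => (hP.not_path hxv.symm hyv.symm (Ne.symm hyu) huv.symm hux hxy).elim,
              fun hvy => (hP.not_path hxv hyx.symm (Ne.symm hyu) hux.symm huv hvy).elim⟩
        by_cases h1 : ∀ x, x ≠ u → x ≠ v → (H.black.Adj u x ↔ H.black.Adj v x)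
        · exact ⟨u, H.black_mem _ _ huv, v, H.black_mem _ _ huv.symm, huv.ne, h1⟩
        push Not at h1
        obtain ⟨x, hxu, hxv, ⟨h2, h3⟩ | ⟨h2, h3⟩⟩ := h1
        · exact ⟨x, H.black_mem _ _ h2.symm, v, H.black_mem _ _ huv.symm, hxv,
            key u v x huv h2 hxv h3⟩
        · exact ⟨x, H.black_mem _ _ h3.symm, u, H.black_mem _ _ huv, hxu,
            key v u x huv.symm h3 hxu h2⟩
      · push Not at he
        obtain ⟨u, hu, v, hv, huv⟩ := Finset.one_lt_card.1 (show 1 < H.verts.card by omega)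
        exact ⟨u, hu, v, hv, huv, fun x _ _ => iff_of_false (he _ _) (he _ _)⟩
    refine (ih ?_ ?_ ?_ ?_).cons ⟨u, hu, v, hv, huv, rfl⟩ (maxRedDegree_eq_zero hred)
    · exact ⟨u, by simp [verts_contract hu huv, hu, huv]⟩
    · have key : ∀ x, x ≠ u → x ≠ v → ¬ H.NewRed u v x := by
        rintro x hxu hxv ⟨h1, h2⟩
        by_cases hb : H.black.Adj u x
        · exact h1 ⟨hb, (htw x hxu hxv).1 hb⟩
        · exact h2 ⟨fun e => e.elim hb (hred _ _),
            fun e => e.elim (fun e => hb ((htw x hxu hxv).2 e)) (hred _ _)⟩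
      rintro x y ⟨hxy, hxv, hyv, h4⟩
      split_ifs at h4 with hxu hyu
      · exact key y (fun e => hxy (hxu.trans e.symm)) hyv h4
      · exact key x hxu hxv h4
      · exact hred _ _ h4
    · intro f hf hadj
      refine hP f hf fun i j hij => ?_
      obtain ⟨-, -, -, h4⟩ := hadj i j hij
      split_ifs at h4 with h1 h2
      · rw [h1]; exact h4.1
      · rw [h2]; exact h4.1.symm
      · exact h4
    · rw [verts_contract hu huv, Finset.card_erase_of_mem hv, hn]; rfl

/-! ### Contracting caterpillars -/

/-- Contracting two vertices without further neighbours creates no red edge. -/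
theorem not_red_contract {H : Trigraph V} {u v x y : V} (hred : ∀ x y, ¬ H.red.Adj x y)
    (hu : ∀ y, y ≠ v → ¬ H.IsEdge u y) (hv : ∀ y, y ≠ u → ¬ H.IsEdge v y) :
    ¬ (H.contract u v).red.Adj x y := by
  intro h
  obtain ⟨hxy, hxv, hyv, h | ⟨rfl, h⟩ | ⟨rfl, h⟩⟩ := red_contract h
  · exact hred _ _ h.2.2
  · exact h.elim (hu _ hyv) (hv _ hxy.symm)
  · exact h.elim (hu _ hxv) (hv _ hxy)

end Trigraph

section Caterpillar

variable {V : Type*} {G : SimpleGraph V}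

/-- Inside `S`, the vertex `y` is a neighbour of `x` that has a further neighbour. -/
def InnerNeighbor (G : SimpleGraph V) (S : Finset V) (x y : V) : Prop :=
  y ∈ S ∧ G.Adj x y ∧ ∃ w ∈ S, w ≠ x ∧ G.Adj y w

theorem InnerNeighbor.mono {S T : Finset V} {x y : V} (h : InnerNeighbor G S x y) (hST : S ⊆ T) :
    InnerNeighbor G T x y :=
  ⟨hST h.1, h.2.1, h.2.2.imp fun _ hw => ⟨hST hw.1, hw.2⟩⟩

/-- In a graph without cycles and spiders no vertex has three inner neighbours. -/
theorem innerNeighbor_unique (hC : CycleFree G) (hP : OmitsSubgraph G (parentGraph spiderParent))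
    {S : Finset V} {y a b c : V} (ha : InnerNeighbor G S y a) (hb : InnerNeighbor G S y b)
    (hc : InnerNeighbor G S y c) (hac : a ≠ c) (hbc : b ≠ c) : a = b := by
  by_contra hab
  obtain ⟨-, ha, a', -, hya', ha'⟩ := ha
  obtain ⟨-, hb, b', -, hyb', hb'⟩ := hb
  obtain ⟨-, hc, c', -, hyc', hc'⟩ := hc
  have tri : ∀ {a b a'}, G.Adj y a → G.Adj y b → G.Adj a a' → a' ≠ b := by
    rintro a b a' ha hb ha' rfl
    exact hC.not_triangle ha ha' hb
  have sq : ∀ {a b a' b'}, a ≠ b → y ≠ a' → G.Adj y a → G.Adj y b → G.Adj a a' → G.Adj b b' →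
      a' ≠ b' := by
    rintro a b a' b' hab hya ha hb ha' hb' rfl
    exact hC.not_square hya hab ha ha' hb'.symm hb
  have e1 := tri ha hb ha'
  have e2 := tri ha hc ha'
  have e3 := tri hb ha hb'
  have e4 := tri hb hc hb'
  have e5 := tri hc ha hc'
  have e6 := tri hc hb hc'
  have e7 := sq hab hya'.symm ha hb ha' hb'
  have e8 := sq hac hya'.symm ha hc ha' hc'
  have e9 := sq hbc hyb'.symm hb hc hb' hc'
  have := ha.ne; have := hb.ne; have := hc.ne
  have := ha'.ne; have := hb'.ne; have := hc'.ne
  refine hP.not_spider (y := y) (a := a) (b := b) (c := c) (a' := a') (b' := b') (c' := c') ?_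
    ha hb hc ha' hb' hc'
  rw [← List.nodup_ofFn]
  simp only [List.ofFn_succ, List.ofFn_zero, Matrix.cons_val_zero, Matrix.cons_val_succ,
    List.nodup_cons, List.mem_cons, List.not_mem_nil, or_false, not_or, not_false_eq_true,
    List.nodup_nil, and_true]
  grind

end Caterpillar

/-! ### Longest paths -/

section LongestPath

variable {V : Type*} {G : SimpleGraph V}

/-- `f` is a longest path of `G` inside `S`; it has `k` edges. -/
structure IsLongestPath (G : SimpleGraph V) (S : Finset V) {k : ℕ} (f : Fin (k + 1) → V) : Prop
    extends IsPathSeq G f where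
  mem : ∀ i, f i ∈ S
  le : ∀ (m : ℕ) (g : Fin (m + 1) → V), IsPathSeq G g → (∀ i, g i ∈ S) → m ≤ k

theorem exists_isLongestPath (G : SimpleGraph V) {S : Finset V} (hS : S.Nonempty) :
    ∃ (k : ℕ) (f : Fin (k + 1) → V), IsLongestPath G S f := by
  classical
  let p : ℕ → Prop := fun k => ∃ f : Fin (k + 1) → V, IsPathSeq G f ∧ ∀ i, f i ∈ S
  have hb : ∀ k, p k → k ≤ S.card := by
    rintro k ⟨f, hf, hfS⟩
    have := Finset.card_le_card_of_injOn (s := Finset.univ) f (fun i _ => hfS i) hf.inj.injOn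
    simp at this
    omega
  obtain ⟨x, hx⟩ := hS
  have h0 : p 0 := ⟨fun _ => x, ⟨fun i j _ => Subsingleton.elim (α := Fin 1) i j,
    fun i j hij => by omega⟩, fun _ => hx⟩
  obtain ⟨f, hf, hfS⟩ := Nat.findGreatest_spec (P := p) (Nat.zero_le S.card) h0
  exact ⟨_, f, hf, hfS, fun m g hg hgS =>
    Nat.le_findGreatest (hb m ⟨g, hg, hgS⟩) ⟨g, hg, hgS⟩⟩

theorem IsLongestPath.of_isPathSeq {S : Finset V} {k : ℕ} {f g : Fin (k + 1) → V}
    (h : IsLongestPath G S f) (hg : IsPathSeq G g) (hgS : ∀ i, g i ∈ S) : IsLongestPath G S g :=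
  ⟨hg, hgS, h.le⟩

/-- All neighbours in `S` of the first vertex of a longest path lie on the path. -/
theorem IsLongestPath.exists_of_adj {S : Finset V} {k : ℕ} {f : Fin (k + 1) → V}
    (h : IsLongestPath G S f) {y : V} (hy : y ∈ S) (hadj : G.Adj (f 0) y) : ∃ i, f i = y := by
  by_contra! hn
  have : k + 1 ≤ k := by
    refine h.le (k + 1) (Fin.cons y f : Fin (k + 1 + 1) → V) ⟨?_, ?_⟩ ?_
    · rw [Fin.cons_injective_iff]
      exact ⟨fun ⟨i, hi⟩ => hn i hi, h.inj⟩
    · intro i j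
      refine Fin.cases ?_ (fun i => ?_) i <;> refine Fin.cases ?_ (fun j => ?_) j
      · simp
      · intro hj
        have : j = 0 := Fin.ext (by simpa using hj.symm)
        subst this
        simpa using hadj.symm
      · simp
      · intro hij
        simpa using h.adj i j (by simpa using hij)
    · intro i
      refine Fin.cases ?_ (fun i => ?_) i
      · simpa using hy
      · simpa using h.mem i
  omega

theorem CycleFree.not_adj_of_isPathSeq (hC : CycleFree G) {k : ℕ} {f : Fin (k + 1) → V}
    (hf : IsPathSeq G f) {i : Fin (k + 1)} (hi : 2 ≤ (i : ℕ)) : ¬ G.Adj (f 0) (f i) := by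
  intro hadj
  have hik : ∀ j : Fin ((i : ℕ) - 2 + 3), (j : ℕ) < k + 1 := fun j => by omega
  refine hC (i - 2) (fun j => f ⟨j, hik j⟩) ⟨?_, ?_⟩ ?_
  · intro a b hab
    exact Fin.ext (by simpa using hf.inj hab)
  · intro a b hab
    exact hf.adj _ _ hab
  · have : (⟨i - 2 + 2, hik (Fin.last _)⟩ : Fin (k + 1)) = i := Fin.ext (by simp; omega)
    simpa [Fin.last, this] using hadj

/-- Every nonempty set of vertices of a graph without cycles has a vertex with at most one neighbour
in the set. -/
theorem CycleFree.exists_low_degree (hC : CycleFree G) {S : Finset V} (hS : S.Nonempty) :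
    ∃ x ∈ S, ∀ y ∈ S, ∀ z ∈ S, G.Adj x y → G.Adj x z → y = z := by
  obtain ⟨k, f, hf⟩ := exists_isLongestPath G hS
  refine ⟨f 0, hf.mem 0, fun y hy z hz hxy hxz => ?_⟩
  obtain ⟨i, rfl⟩ := hf.exists_of_adj hy hxy
  obtain ⟨j, rfl⟩ := hf.exists_of_adj hz hxz
  have key : ∀ i, G.Adj (f 0) (f i) → (i : ℕ) = 1 := by
    intro i hi
    have h0 : (i : ℕ) ≠ 0 := fun h0 => hi.ne (congrArg f (Fin.ext h0.symm))
    by_contra h1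
    exact hC.not_adj_of_isPathSeq hf.toIsPathSeq (i := i) (by omega) hi
  exact congrArg f (Fin.ext ((key i hxy).trans (key j hxz).symm))

/-- The end of a caterpillar: a leaf `u` whose neighbour `x` has at most one inner neighbour. -/
theorem CycleFree.exists_end (hC : CycleFree G) {S : Finset V}
    (hS : ∃ a ∈ S, ∃ b ∈ S, G.Adj a b) :
    ∃ u ∈ S, ∃ x ∈ S, G.Adj u x ∧ (∀ w ∈ S, G.Adj u w → w = x) ∧
      ∀ y z, InnerNeighbor G S x y → InnerNeighbor G S x z → y = z := by
  classical
  set N : Finset V := {x ∈ S | ∃ y ∈ S, ∃ z ∈ S, y ≠ z ∧ G.Adj x y ∧ G.Adj x z} with hN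
  have inner : ∀ x ∈ S, ∀ y, InnerNeighbor G S x y → y ∈ N := by
    rintro x hx y ⟨hy, hxy, w, hw, hwx, hyw⟩
    exact Finset.mem_filter.2 ⟨hy, x, hx, w, hw, hwx.symm, hxy.symm, hyw⟩
  have leaf : ∀ u ∈ S, u ∉ N → ∀ x ∈ S, G.Adj u x → ∀ w ∈ S, G.Adj u w → w = x := by
    intro u hu hun x hx hux w hw huw
    by_contra hwx
    exact hun (Finset.mem_filter.2 ⟨hu, w, hw, x, hx, hwx, huw, hux⟩)
  rcases N.eq_empty_or_nonempty with hNe | hNe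
  · obtain ⟨u, hu, x, hx, hux⟩ := hS
    refine ⟨u, hu, x, hx, hux, leaf u hu (by simp [hNe]) x hx hux, fun y z hy _ => ?_⟩
    have := inner x hx y hy
    simp [hNe] at this
  · obtain ⟨x, hxN, hx⟩ := hC.exists_low_degree hNe
    obtain ⟨hxS, y, hy, z, hz, hyz, hxy, hxz⟩ := Finset.mem_filter.1 hxN
    obtain ⟨u, hu, hxu, huN⟩ : ∃ u ∈ S, G.Adj x u ∧ u ∉ N := by
      by_contra! hcon
      exact hyz (hx y (hcon y hy hxy) z (hcon z hz hxz) hxy hxz)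
    exact ⟨u, hu, x, hxS, hxu.symm, leaf u hu huN x hxS hxu.symm, fun a b ha hb =>
      hx a (inner x hxS a ha) b (inner x hxS b hb) ha.2.1 hb.2.1⟩

end LongestPath

namespace Trigraph

variable {V : Type*} [DecidableEq V] {G : SimpleGraph V}

/-- A trigraph whose edges lie in a caterpillar forest can be contracted with red degree at most one
when it has at most one red edge `ux`, where `u` is a leaf and `x` ends the spine of its
caterpillar. -/
theorem hasContractionSequence_one_of_pendant (hC : CycleFree G)
    (hP : OmitsSubgraph G (parentGraph spiderParent)) (n : ℕ) :
    ∀ H : Trigraph V, H.verts.card = n → H.verts.Nonempty →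
      (∀ a b, H.IsEdge a b → G.Adj a b) →
      ((∀ a b, ¬ H.red.Adj a b) ∨ ∃ u ∈ H.verts, ∃ x ∈ H.verts, G.Adj u x ∧
        (∀ w ∈ H.verts, G.Adj u w → w = x) ∧
        (∀ y z, InnerNeighbor G H.verts x y → InnerNeighbor G H.verts x z → y = z) ∧
        ∀ a b, H.red.Adj a b → (a = u ∧ b = x) ∨ (a = x ∧ b = u)) →
      H.HasContractionSequence 1 := by
  induction n with
  | zero => exact fun H hn hne => (hne.card_ne_zero hn).elim
  | succ n ih =>
    intro H hn hne hE hR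
    have hdeg : H.maxRedDegree ≤ 1 := by
      refine maxRedDegree_le_one fun a b c hb hc => ?_
      rcases hR with hR | ⟨u, -, x, -, hux, -, -, hR⟩
      · exact (hR _ _ hb).elim
      · have := hux.ne
        rcases hR a b hb with h1 | h1 <;> rcases hR a c hc with h2 | h2 <;> grind
    by_cases hn0 : n = 0
    · exact hasContractionSequence_of_card_eq_one (by omega) hdeg
    have hcard : ∀ u ∈ H.verts, ∀ v ∈ H.verts, u ≠ v → (H.contract u v).verts.card = n := by
      intro u hu v hv huv
      rw [verts_contract hu huv, Finset.card_erase_of_mem hv, hn]; rfl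
    have hne' : ∀ u ∈ H.verts, ∀ v ∈ H.verts, u ≠ v → (H.contract u v).verts.Nonempty :=
      fun u hu v hv huv => ⟨u, by simp [verts_contract hu huv, hu, huv]⟩
    by_cases hedge : ∃ a ∈ H.verts, ∃ b ∈ H.verts, G.Adj a b
    swap
    · push Not at hedge
      have hno : ∀ a b, ¬ H.IsEdge a b := fun a b h =>
        hedge a h.mem_left b h.mem_right (hE a b h)
      obtain ⟨u, hu, v, hv, huv⟩ := Finset.one_lt_card.1 (show 1 < H.verts.card by omega)
      refine (ih _ (hcard u hu v hv huv) (hne' u hu v hv huv) ?_ (Or.inl fun a b =>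
        not_red_contract (fun x y h => hno x y (Or.inr h)) (fun y _ => hno _ _)
          fun y _ => hno _ _)).cons ⟨u, hu, v, hv, huv, rfl⟩ hdeg
      intro a b hab
      obtain ⟨-, -, -, h | ⟨-, h⟩ | ⟨-, h⟩⟩ := isEdge_contract hab
      · exact hE _ _ h.2.2
      · exact (h.elim (hno _ _) (hno _ _)).elim
      · exact (h.elim (hno _ _) (hno _ _)).elim
    obtain ⟨u, hu, x, hx, hux, hleaf, hin, hR⟩ : ∃ u ∈ H.verts, ∃ x ∈ H.verts, G.Adj u x ∧
        (∀ w ∈ H.verts, G.Adj u w → w = x) ∧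
        (∀ y z, InnerNeighbor G H.verts x y → InnerNeighbor G H.verts x z → y = z) ∧
        ∀ a b, H.red.Adj a b → (a = u ∧ b = x) ∨ (a = x ∧ b = u) := by
      rcases hR with hR | hR
      · obtain ⟨u, hu, x, hx, h1, h2, h3⟩ := hC.exists_end hedge
        exact ⟨u, hu, x, hx, h1, h2, h3, fun a b h => (hR a b h).elim⟩
      · exact hR
    have hEu : ∀ w, H.IsEdge u w → w = x := fun w h => hleaf w h.mem_right (hE _ _ h)
    by_cases hv : ∃ v ∈ H.verts, v ≠ u ∧ G.Adj x v ∧ ∀ w ∈ H.verts, G.Adj v w → w = x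
    · -- Merge the leaf `v` into its sibling `u`.
      obtain ⟨v, hv, hvu, hxv, hleafv⟩ := hv
      have hEv : ∀ w, H.IsEdge v w → w = x := fun w h => hleafv w h.mem_right (hE _ _ h)
      have hsub : (H.contract u v).verts ⊆ H.verts := by
        rw [verts_contract hu hvu.symm]; exact Finset.erase_subset _ _
      refine (ih _ (hcard u hu v hv hvu.symm) (hne' u hu v hv hvu.symm) ?_
        (Or.inr ⟨u, ?_, x, ?_, hux, fun w hw => hleaf w (hsub hw),
          fun y z hy hz => hin y z (hy.mono hsub) (hz.mono hsub), ?_⟩)).cons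
        ⟨u, hu, v, hv, hvu.symm, rfl⟩ hdeg
      · intro a b hab
        obtain ⟨-, -, -, h | ⟨rfl, h⟩ | ⟨rfl, h⟩⟩ := isEdge_contract hab
        · exact hE _ _ h.2.2
        · rw [h.elim (hEu _) (hEv _)]; exact hux
        · rw [h.elim (hEu _) (hEv _)]; exact hux.symm
      · simp [verts_contract hu hvu.symm, hu, hvu.symm]
      · simp [verts_contract hu hvu.symm, hx, hxv.ne]
      · intro a b hab
        obtain ⟨-, -, -, h | ⟨rfl, h⟩ | ⟨rfl, h⟩⟩ := red_contract hab
        · exact hR _ _ h.2.2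
        · exact Or.inl ⟨rfl, h.elim (hEu _) (hEv _)⟩
        · exact Or.inr ⟨h.elim (hEu _) (hEv _), rfl⟩
    · -- All further neighbours of `x` are inner, hence there is at most one: contract `u` into `x`.
      have hinner : ∀ v ∈ H.verts, v ≠ u → G.Adj x v → InnerNeighbor G H.verts x v := by
        intro v hvS hvu hxv
        by_contra hn
        refine hv ⟨v, hvS, hvu, hxv, fun w hw hvw => ?_⟩
        by_contra hwx
        exact hn ⟨hvS, hxv, w, hw, hwx, hvw⟩
      have hxu := hux.ne.symm
      have hsub : (H.contract x u).verts ⊆ H.verts := by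
        rw [verts_contract hx hxu]; exact Finset.erase_subset _ _
      have hE' : ∀ a b, (H.contract x u).IsEdge a b → G.Adj a b := by
        intro a b hab
        obtain ⟨hne, hau, hbu, h | ⟨rfl, h⟩ | ⟨rfl, h⟩⟩ := isEdge_contract hab
        · exact hE _ _ h.2.2
        · exact h.elim (hE _ _) fun h => (hne (hEu _ h).symm).elim
        · exact h.elim (fun h => (hE _ _ h).symm) fun h => (hne (hEu _ h)).elim
      have hR' : ∀ a b, (H.contract x u).red.Adj a b →
          (a = x ∧ InnerNeighbor G H.verts x b) ∨ (b = x ∧ InnerNeighbor G H.verts x a) := by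
        intro a b hab
        obtain ⟨hne, hau, hbu, h | ⟨rfl, h⟩ | ⟨rfl, h⟩⟩ := red_contract hab
        · rcases hR _ _ h.2.2 with h' | h'
          · exact (hau h'.1).elim
          · exact (hbu h'.2).elim
        · rcases h with h | h
          · exact Or.inl ⟨rfl, hinner b h.mem_right hbu (hE _ _ h)⟩
          · exact (hne (hEu _ h).symm).elim
        · rcases h with h | h
          · exact Or.inr ⟨rfl, hinner a h.mem_right hau (hE _ _ h)⟩
          · exact (hne (hEu _ h)).elim
      refine (ih _ (hcard x hx u hu hxu) (hne' x hx u hu hxu) hE' ?_).cons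
        ⟨x, hx, u, hu, hxu, rfl⟩ hdeg
      by_cases hy : ∃ y, InnerNeighbor G H.verts x y
      · obtain ⟨y, hy⟩ := hy
        have hyu : y ≠ u := by
          rintro rfl
          obtain ⟨-, -, w, hw, hwx, hyw⟩ := hy
          exact hwx (hleaf w hw hyw)
        have hleaf' : ∀ w ∈ (H.contract x u).verts, G.Adj x w → w = y := by
          intro w hw hxw
          rw [verts_contract hx hxu, Finset.mem_erase] at hw
          exact hin w y (hinner w hw.2 hw.1 hxw) hy
        have hnot : ∀ a, InnerNeighbor G (H.contract x u).verts y a → a ≠ x := by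
          rintro a ⟨-, -, w, hw, hwy, haw⟩ rfl
          exact hwy (hleaf' w hw haw)
        refine Or.inr ⟨x, ?_, y, ?_, hy.2.1, hleaf', ?_, ?_⟩
        · simp [verts_contract hx hxu, hx, hxu]
        · simp [verts_contract hx hxu, hy.1, hyu]
        · intro a b ha hb
          exact innerNeighbor_unique hC hP (c := x) (ha.mono hsub) (hb.mono hsub)
            ⟨hx, hy.2.1.symm, u, hu, hyu.symm, hux.symm⟩ (hnot a ha) (hnot b hb)
        · intro a b hab
          rcases hR' a b hab with ⟨rfl, h⟩ | ⟨rfl, h⟩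
          · exact Or.inl ⟨rfl, hin _ _ h hy⟩
          · exact Or.inr ⟨hin _ _ h hy, rfl⟩
      · push Not at hy
        exact Or.inl fun a b hab => (hR' a b hab).elim (fun h => hy _ h.2) fun h => hy _ h.2

theorem hasContractionSequence_one [Fintype V] [Nonempty V] (hC : CycleFree G)
    (hP : OmitsSubgraph G (parentGraph spiderParent)) : (ofGraph G).HasContractionSequence 1 :=
  hasContractionSequence_one_of_pendant hC hP _ (ofGraph G) rfl Finset.univ_nonempty
    (fun _ _ h => h.elim id fun h => h.elim) (Or.inl fun _ _ h => h)

end Trigraph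

/-! ### Contracting pseudoforests -/

/-- A rooted forest on `S`, given by a parent function `par` (roots are their own parents), the root
function `rt` and a function `d` increasing away from the roots. The vertices `b ∈ mk` carry an
additional edge from `b` to the root `rt b`, at most one for each root, which turns the component
into a unicyclic one. The set `hot` is closed under taking children; at a root with an additional
edge it consists of the descendants of a single child, among them the other end of that edge. -/
structure Frame {V : Type*} (S : Finset V) (par rt : V → V) (d : V → ℕ) (hot mk : Set V) :
    Prop where
  par_mem : ∀ x ∈ S, par x ∈ S
  lt : ∀ x ∈ S, par x ≠ x → d (par x) < d x
  rt_par : ∀ x ∈ S, rt (par x) = rt x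
  rt_root : ∀ x ∈ S, par x = x → rt x = x
  hot_child : ∀ x ∈ S, par x ∈ hot → x ∈ hot
  hot_par : ∀ x ∈ S, x ∈ hot → par x ∈ hot ∨ par x = rt x
  mk_mem : ∀ b ∈ mk, b ∈ S
  mk_hot : ∀ b ∈ mk, b ∈ hot
  rt_mem : ∀ b ∈ mk, rt b ∈ S
  rt_cold : ∀ b ∈ mk, rt b ∉ hot
  par_rt : ∀ b ∈ mk, par (rt b) = rt b
  mk_unique : ∀ b ∈ mk, ∀ b' ∈ mk, rt b = rt b' → b = b'
  hot_unique : ∀ b ∈ mk, ∀ x ∈ S, ∀ y ∈ S, x ∈ hot → y ∈ hot → par x = rt b → par y = rt b → x = y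

/-- The vertex `x` has no children in `S`. -/
def IsLeafIn {V : Type*} (S : Finset V) (par : V → V) (x : V) : Prop := ∀ y ∈ S, par y = x → y = x

theorem IsLeafIn.mono {V : Type*} {S T : Finset V} {par : V → V} {x : V} (h : IsLeafIn T par x)
    (hST : S ⊆ T) : IsLeafIn S par x := fun y hy => h y (hST hy)

/-- Deleting a hot leaf `v` and passing its additional edge on to a hot vertex `w` with the same
root. -/
theorem Frame.erase {V : Type*} [DecidableEq V] {S : Finset V} {par rt : V → V} {d : V → ℕ}
    {hot mk : Set V} (F : Frame S par rt d hot mk) {v w : V} (hv : IsLeafIn S par v)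
    (hvh : v ∈ hot) (hw : w ∈ S) (hwv : w ≠ v) (hwh : w ∈ hot) (hrt : rt w = rt v) :
    Frame (S.erase v) par rt d hot {b | b ≠ v ∧ (b ∈ mk ∨ (b = w ∧ v ∈ mk))} := by
  have hS : ∀ x ∈ S.erase v, x ∈ S := fun x hx => Finset.mem_of_mem_erase hx
  refine ⟨?_, fun x hx => F.lt x (hS x hx), fun x hx => F.rt_par x (hS x hx),
    fun x hx => F.rt_root x (hS x hx), fun x hx => F.hot_child x (hS x hx),
    fun x hx => F.hot_par x (hS x hx), ?_, ?_, ?_, ?_, ?_, ?_, ?_⟩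
  · exact fun x hx => Finset.mem_erase.2
      ⟨fun e => (Finset.ne_of_mem_erase hx) (hv x (hS x hx) e), F.par_mem x (hS x hx)⟩
  · rintro b ⟨hbv, hb | ⟨rfl, hb⟩⟩
    · exact Finset.mem_erase.2 ⟨hbv, F.mk_mem b hb⟩
    · exact Finset.mem_erase.2 ⟨hbv, hw⟩
  · rintro b ⟨hbv, hb | ⟨rfl, hb⟩⟩
    · exact F.mk_hot b hb
    · exact hwh
  · rintro b ⟨hbv, hb | ⟨rfl, hb⟩⟩
    · exact Finset.mem_erase.2 ⟨fun e => F.rt_cold b hb (e ▸ hvh), F.rt_mem b hb⟩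
    · rw [hrt]
      exact Finset.mem_erase.2 ⟨fun e => F.rt_cold v hb (e.symm ▸ hvh), F.rt_mem v hb⟩
  · rintro b ⟨hbv, hb | ⟨rfl, hb⟩⟩
    · exact F.rt_cold b hb
    · rw [hrt]; exact F.rt_cold v hb
  · rintro b ⟨hbv, hb | ⟨rfl, hb⟩⟩
    · exact F.par_rt b hb
    · rw [hrt]; exact F.par_rt v hb
  · rintro b ⟨hbv, hb | ⟨rfl, hb⟩⟩ b' ⟨hbv', hb' | ⟨rfl, hb'⟩⟩ h
    · exact F.mk_unique b hb b' hb' h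
    · exact (hbv (F.mk_unique b hb v hb' (h.trans hrt))).elim
    · exact (hbv' (F.mk_unique b' hb' v hb (h.symm.trans hrt))).elim
    · rfl
  · rintro b ⟨hbv, hb | ⟨rfl, hb⟩⟩ x hx y hy hxh hyh h1 h2
    · exact F.hot_unique b hb x (hS x hx) y (hS y hy) hxh hyh h1 h2
    · exact F.hot_unique v hb x (hS x hx) y (hS y hy) hxh hyh (h1.trans hrt) (h2.trans hrt)

namespace Trigraph

variable {V : Type*}

/-- The edges of `H` lie in the pseudoforest described by the frame. The red ones join a vertex of
`Rd` to its parent, or a leaf carrying an additional edge to its root; all vertices of `Rd` are hot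
leaves, and distinct ones have distinct parents unless `x₀`, the vertex produced by the last
contraction, is involved. -/
structure Framed (H : Trigraph V) (par rt : V → V) (d : V → ℕ) (hot mk Rd : Set V) (x₀ : V) : Prop
    extends Frame H.verts par rt d hot mk where
  edge : ∀ x y, H.IsEdge x y →
    (par x = y ∨ (x ∈ mk ∧ rt x = y)) ∨ (par y = x ∨ (y ∈ mk ∧ rt y = x))
  red : ∀ x y, H.red.Adj x y →
    ((x ∈ Rd ∧ par x = y) ∨ (x ∈ mk ∧ IsLeafIn H.verts par x ∧ rt x = y)) ∨
    ((y ∈ Rd ∧ par y = x) ∨ (y ∈ mk ∧ IsLeafIn H.verts par y ∧ rt y = x))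
  rd_mem : ∀ x ∈ Rd, x ∈ H.verts
  rd_hot : ∀ x ∈ Rd, x ∈ hot
  rd_leaf : ∀ x ∈ Rd, IsLeafIn H.verts par x
  rd_ne : ∀ x ∈ Rd, par x ≠ x
  rd_unique : ∀ x ∈ Rd, ∀ y ∈ Rd, par x = par y → x ≠ y → x = x₀ ∨ y = x₀

variable {H : Trigraph V} {par rt : V → V} {d : V → ℕ} {hot mk Rd : Set V} {x₀ : V}

theorem Framed.maxRedDegree_le (F : Framed H par rt d hot mk Rd x₀) : H.maxRedDegree ≤ 2 := by
  refine maxRedDegree_le_two fun x => ?_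
  by_cases hx : x ∈ Rd
  · refine ⟨par x, rt x, fun y hxy => ?_⟩
    rcases F.red x y hxy with (h | h) | (h | h)
    · exact Or.inl h.2.symm
    · exact Or.inr h.2.2.symm
    · exact (hxy.ne (F.rd_leaf x hx y (F.rd_mem y h.1) h.2).symm).elim
    · have := F.par_rt y h.1
      rw [h.2.2] at this
      exact (F.rd_ne x hx this).elim
  by_cases hx' : x ∈ mk ∧ IsLeafIn H.verts par x
  · refine ⟨rt x, rt x, fun y hxy => ?_⟩
    rcases F.red x y hxy with (h | h) | (h | h)
    · exact (hx h.1).elim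
    · exact Or.inl h.2.2.symm
    · exact (hxy.ne (hx'.2 y (F.rd_mem y h.1) h.2).symm).elim
    · exact (F.rt_cold y h.1 (h.2.2 ▸ F.mk_hot x hx'.1)).elim
  have key : ∀ y, H.red.Adj x y → (y ∈ Rd ∧ par y = x) ∨ (y ∈ mk ∧ rt y = x) := by
    intro y hxy
    rcases F.red x y hxy with (h | h) | (h | h)
    · exact (hx h.1).elim
    · exact (hx' ⟨h.1, h.2.1⟩).elim
    · exact Or.inl h
    · exact Or.inr ⟨h.1, h.2.2⟩
  by_cases hb : ∃ b ∈ mk, rt b = x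
  · obtain ⟨b, hb, rfl⟩ := hb
    by_cases hc : ∃ c ∈ Rd, par c = rt b
    · obtain ⟨c, hc, hcb⟩ := hc
      refine ⟨b, c, fun y hy => ?_⟩
      rcases key y hy with h | h
      · exact Or.inr (F.hot_unique b hb y (F.rd_mem y h.1) c (F.rd_mem c hc) (F.rd_hot y h.1)
          (F.rd_hot c hc) h.2 hcb)
      · exact Or.inl (F.mk_unique y h.1 b hb h.2)
    · refine ⟨b, b, fun y hy => ?_⟩
      rcases key y hy with h | h
      · exact (hc ⟨y, h⟩).elim
      · exact Or.inl (F.mk_unique y h.1 b hb h.2)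
  · have key' : ∀ y, H.red.Adj x y → y ∈ Rd ∧ par y = x := fun y hy =>
      (key y hy).resolve_right fun h => hb ⟨y, h⟩
    by_cases hc : ∃ c, H.red.Adj x c ∧ c ≠ x₀
    · obtain ⟨c, hc, hcx⟩ := hc
      refine ⟨x₀, c, fun y hy => ?_⟩
      by_contra! hn
      obtain ⟨h1, h2⟩ := key' y hy
      obtain ⟨h3, h4⟩ := key' c hc
      exact (F.rd_unique y h1 c h3 (h2.trans h4.symm) hn.2).elim hn.1 hcx
    · push Not at hc
      exact ⟨x₀, x₀, fun y hy => Or.inl (hc y hy)⟩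

theorem Framed.par_eq_rt (F : Framed H par rt d hot mk Rd x₀)
    (hleaf : ∀ x ∈ H.verts, x ∈ hot → IsLeafIn H.verts par x) {b : V} (hb : b ∈ mk) :
    par b = rt b := by
  have hbS := F.mk_mem b hb
  refine (F.hot_par b hbS (F.mk_hot b hb)).resolve_left fun h => ?_
  have e : b = par b := hleaf _ (F.par_mem b hbS) h b hbS rfl
  have := F.rt_cold b hb
  rw [F.rt_root b hbS e.symm] at this
  exact this (F.mk_hot b hb)

theorem Framed.union_unique (F : Framed H par rt d hot mk Rd x₀)
    (huniq : ∀ x ∈ Rd, ∀ y ∈ Rd, par x = par y → x = y)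
    (hleaf : ∀ x ∈ H.verts, x ∈ hot → IsLeafIn H.verts par x) :
    ∀ x ∈ Rd ∪ mk, ∀ y ∈ Rd ∪ mk, par x = par y → x = y := by
  have hmem : ∀ x ∈ Rd ∪ mk, x ∈ H.verts := fun x hx => hx.elim (F.rd_mem x) (F.mk_mem x)
  have hhot : ∀ x ∈ Rd ∪ mk, x ∈ hot := fun x hx => hx.elim (F.rd_hot x) (F.mk_hot x)
  intro x hx y hy hxy
  rcases id hx with hx' | hx'
  · rcases id hy with hy' | hy'
    · exact huniq x hx' y hy' hxy
    · exact F.hot_unique y hy' x (hmem x hx) y (hmem y hy) (hhot x hx) (hhot y hy)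
        (hxy.trans (F.par_eq_rt hleaf hy')) (F.par_eq_rt hleaf hy')
  · exact F.hot_unique x hx' x (hmem x hx) y (hmem y hy) (hhot x hx) (hhot y hy)
      (F.par_eq_rt hleaf hx') (hxy.symm.trans (F.par_eq_rt hleaf hx'))

/-- Once every hot vertex is a leaf, the additional edges coincide with edges of the forest, and
all vertices can be declared hot. -/
theorem Framed.heat (F : Framed H par rt d hot mk Rd x₀)
    (huniq : ∀ x ∈ Rd, ∀ y ∈ Rd, par x = par y → x = y)
    (hleaf : ∀ x ∈ H.verts, x ∈ hot → IsLeafIn H.verts par x) :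
    Framed H par rt d Set.univ ∅ (Rd ∪ mk) x₀ := by
  have hmk : ∀ b ∈ mk, par b = rt b := fun b hb => F.par_eq_rt hleaf hb
  have hmem : ∀ x ∈ Rd ∪ mk, x ∈ H.verts := fun x hx => hx.elim (F.rd_mem x) (F.mk_mem x)
  have hhot : ∀ x ∈ Rd ∪ mk, x ∈ hot := fun x hx => hx.elim (F.rd_hot x) (F.mk_hot x)
  refine ⟨⟨F.par_mem, F.lt, F.rt_par, F.rt_root, fun _ _ _ => trivial, fun _ _ _ => Or.inl trivial,
    fun _ h => h.elim, fun _ h => h.elim, fun _ h => h.elim, fun _ h => h.elim, fun _ h => h.elim,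
    fun _ h => h.elim, fun _ h => h.elim⟩, ?_, ?_, hmem, fun _ _ => trivial,
    fun x hx => hleaf x (hmem x hx) (hhot x hx), ?_, fun x hx y hy hxy hne =>
      (hne (F.union_unique huniq hleaf x hx y hy hxy)).elim⟩
  · intro x y hxy
    exact (F.edge x y hxy).imp
      (fun h => Or.inl (h.elim id fun h => (hmk x h.1).trans h.2))
      (fun h => Or.inl (h.elim id fun h => (hmk y h.1).trans h.2))
  · intro x y hxy
    exact (F.red x y hxy).imp
      (fun h => Or.inl (h.elim (fun h => ⟨Or.inl h.1, h.2⟩)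
        fun h => ⟨Or.inr h.1, (hmk x h.1).trans h.2.2⟩))
      (fun h => Or.inl (h.elim (fun h => ⟨Or.inl h.1, h.2⟩)
        fun h => ⟨Or.inr h.1, (hmk y h.1).trans h.2.2⟩))
  · rintro x (hx | hx) e
    · exact F.rd_ne x hx e
    · exact F.rt_cold x hx (((hmk x hx).symm.trans e).symm ▸ F.mk_hot x hx)

variable [DecidableEq V]

/-- A hot leaf `v` may be merged into a sibling leaf `w`, or into its parent `w` when it is the only
child: in both cases `w` is a leaf afterwards. -/
theorem Framed.contract (F : Framed H par rt d hot mk Rd x₀) {v w : V} (hv : v ∈ H.verts)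
    (hw : w ∈ H.verts) (hwv : w ≠ v) (hvh : v ∈ hot) (hwh : w ∈ hot)
    (hvl : IsLeafIn H.verts par v) (hwl : IsLeafIn (H.verts.erase v) par w)
    (hpar : par v = par w ∨ par v = w)
    (huniq : ∀ x ∈ Rd, ∀ y ∈ Rd, x ≠ v → y ≠ v → par x = par y → x = y) :
    Framed (H.contract w v) par rt d hot {b | b ≠ v ∧ (b ∈ mk ∨ (b = w ∧ v ∈ mk))}
      {x | x ≠ v ∧ (x ∈ Rd ∨ (x = w ∧ par w ≠ w))} w := by
  have hrt : rt w = rt v := by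
    rcases hpar with h | h
    · rw [← F.rt_par w hw, ← F.rt_par v hv, h]
    · rw [← F.rt_par v hv, h]
  have hverts := verts_contract hw hwv
  have hsub : H.verts.erase v ⊆ H.verts := Finset.erase_subset _ _
  -- The old neighbours of `v` and `w`, other than `v` and `w`, are the parent and the root of `w`.
  have hnbr : ∀ y, y ≠ w → y ≠ v → (H.IsEdge w y ∨ H.IsEdge v y) →
      par w = y ∨ ((w ∈ mk ∨ v ∈ mk) ∧ rt w = y) := by
    intro y hyw hyv h
    rcases h with h | h
    · rcases F.edge w y h with (h' | h') | (h' | h')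
      · exact Or.inl h'
      · exact Or.inr ⟨Or.inl h'.1, h'.2⟩
      · exact (hyw (hwl y (Finset.mem_erase.2 ⟨hyv, h.mem_right⟩) h')).elim
      · exact (F.rt_cold y h'.1 (h'.2 ▸ hwh)).elim
    · rcases F.edge v y h with (h' | h') | (h' | h')
      · rcases hpar with hp | hp
        · exact Or.inl (hp.symm.trans h')
        · exact (hyw (h'.symm.trans hp)).elim
      · exact Or.inr ⟨Or.inr h'.1, hrt.trans h'.2⟩
      · exact (hyv (hvl y h.mem_right h')).elim
      · exact (F.rt_cold y h'.1 (h'.2 ▸ hvh)).elim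
  have hfr := F.toFrame.erase hvl hvh hw hwv hwh hrt
  rw [← hverts] at hfr hwl hsub
  have hmk : ∀ y, (w ∈ mk ∨ v ∈ mk) ∧ rt w = y →
      w ∈ {b | b ≠ v ∧ (b ∈ mk ∨ (b = w ∧ v ∈ mk))} ∧ rt w = y :=
    fun y h => ⟨⟨hwv, h.1.imp id fun h => ⟨rfl, h⟩⟩, h.2⟩
  refine ⟨hfr, ?_, ?_, ?_, ?_, ?_, ?_, ?_⟩
  · intro x y hxy
    obtain ⟨hne, hxv, hyv, h | ⟨rfl, h⟩ | ⟨rfl, h⟩⟩ := isEdge_contract hxy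
    · exact (F.edge x y h.2.2).imp (Or.imp id fun h => ⟨⟨hxv, Or.inl h.1⟩, h.2⟩)
        (Or.imp id fun h => ⟨⟨hyv, Or.inl h.1⟩, h.2⟩)
    · exact Or.inl ((hnbr y hne.symm hyv h).imp id (hmk y))
    · exact Or.inr ((hnbr x hne hxv h).imp id (hmk x))
  · intro x y hxy
    obtain ⟨hne, hxv, hyv, h | ⟨rfl, h⟩ | ⟨rfl, h⟩⟩ := red_contract hxy
    · exact (F.red x y h.2.2).imp
        (Or.imp (fun h => ⟨⟨hxv, Or.inl h.1⟩, h.2⟩)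
          fun h => ⟨⟨hxv, Or.inl h.1⟩, h.2.1.mono hsub, h.2.2⟩)
        (Or.imp (fun h => ⟨⟨hyv, Or.inl h.1⟩, h.2⟩)
          fun h => ⟨⟨hyv, Or.inl h.1⟩, h.2.1.mono hsub, h.2.2⟩)
    · exact Or.inl ((hnbr y hne.symm hyv h).imp
        (fun h => ⟨⟨hxv, Or.inr ⟨rfl, h.trans_ne hne.symm⟩⟩, h⟩)
        fun h => ⟨(hmk y h).1, hwl, h.2⟩)
    · exact Or.inr ((hnbr x hne hxv h).imp
        (fun h => ⟨⟨hyv, Or.inr ⟨rfl, h.trans_ne hne⟩⟩, h⟩)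
        fun h => ⟨(hmk x h).1, hwl, h.2⟩)
  · rintro x ⟨hxv, hx | ⟨rfl, -⟩⟩
    · rw [hverts]; exact Finset.mem_erase.2 ⟨hxv, F.rd_mem x hx⟩
    · rw [hverts]; exact Finset.mem_erase.2 ⟨hxv, hw⟩
  · rintro x ⟨hxv, hx | ⟨rfl, -⟩⟩
    · exact F.rd_hot x hx
    · exact hwh
  · rintro x ⟨hxv, hx | ⟨rfl, -⟩⟩
    · exact (F.rd_leaf x hx).mono hsub
    · exact hwl
  · rintro x ⟨hxv, hx | ⟨rfl, hx⟩⟩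
    · exact F.rd_ne x hx
    · exact hx
  · rintro x ⟨hxv, hx | ⟨rfl, -⟩⟩ y ⟨hyv, hy | ⟨rfl, -⟩⟩ hxy hne
    · exact (hne (huniq x hx y hy hxv hyv hxy)).elim
    · exact Or.inr rfl
    · exact Or.inl rfl
    · exact Or.inl rfl

/-- A deepest hot vertex with children allows a contraction that keeps the trigraph framed. -/
theorem Framed.exists_contract (F : Framed H par rt d hot mk Rd x₀)
    (huniq : ∀ x ∈ Rd, ∀ y ∈ Rd, par x = par y → x = y)
    (hx : ∃ x ∈ H.verts, x ∈ hot ∧ ¬ IsLeafIn H.verts par x) :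
    ∃ w ∈ H.verts, ∃ v ∈ H.verts, w ≠ v ∧
      ∃ mk' Rd', Framed (H.contract w v) par rt d hot mk' Rd' w := by
  classical
  obtain ⟨x, hx, hmax⟩ := Finset.exists_max_image
    {x ∈ H.verts | x ∈ hot ∧ ¬ IsLeafIn H.verts par x} d
    (by obtain ⟨x, hx, h⟩ := hx; exact ⟨x, Finset.mem_filter.2 ⟨hx, h⟩⟩)
  obtain ⟨hxS, hxh, hxl⟩ := Finset.mem_filter.1 hx
  have hchild : ∀ y ∈ H.verts, par y = x → y ≠ x → y ∈ hot ∧ IsLeafIn H.verts par y := by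
    intro y hy hyx hne
    have hyh := F.hot_child y hy (hyx ▸ hxh)
    refine ⟨hyh, ?_⟩
    by_contra hyl
    have h1 := hmax y (Finset.mem_filter.2 ⟨hy, hyh, hyl⟩)
    have h2 := F.lt y hy (hyx.trans_ne hne.symm)
    rw [hyx] at h2
    omega
  have huniq' : ∀ v, ∀ x ∈ Rd, ∀ y ∈ Rd, x ≠ v → y ≠ v → par x = par y → x = y :=
    fun v x hx y hy _ _ => huniq x hx y hy
  obtain ⟨v, hv, hvx, hne⟩ : ∃ v ∈ H.verts, par v = x ∧ v ≠ x := by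
    simpa [IsLeafIn] using hxl
  obtain ⟨hvh, hvl⟩ := hchild v hv hvx hne
  by_cases hw : ∃ w ∈ H.verts, par w = x ∧ w ≠ x ∧ w ≠ v
  · obtain ⟨w, hw, hwx, hwne, hwv⟩ := hw
    obtain ⟨hwh, hwl⟩ := hchild w hw hwx hwne
    exact ⟨w, hw, v, hv, hwv, _, _, F.contract hv hw hwv hvh hwh hvl
      (hwl.mono (Finset.erase_subset _ _)) (Or.inl (hvx.trans hwx.symm)) (huniq' v)⟩
  · push Not at hw
    refine ⟨x, hxS, v, hv, hne.symm, _, _, F.contract hv hxS hne.symm hvh hxh hvl ?_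
      (Or.inr hvx) (huniq' v)⟩
    intro y hy hyx
    by_contra hyne
    exact Finset.ne_of_mem_erase hy (hw y (Finset.mem_of_mem_erase hy) hyx hyne)

theorem Framed.hasContractionSequence_two (F : Framed H par rt d hot mk Rd x₀)
    (hH : H.verts.Nonempty) : H.HasContractionSequence 2 := by
  induction hn : H.verts.card generalizing H hot mk Rd x₀ with
  | zero => exact (hH.card_ne_zero hn).elim
  | succ n ih =>
    by_cases hn0 : n = 0
    · exact hasContractionSequence_of_card_eq_one (by omega) F.maxRedDegree_le
    have step : ∀ w ∈ H.verts, ∀ v ∈ H.verts, w ≠ v → ∀ hot' mk' Rd',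
        Framed (H.contract w v) par rt d hot' mk' Rd' w → H.HasContractionSequence 2 := by
      intro w hw v hv hwv hot' mk' Rd' F'
      refine (ih F' ⟨w, ?_⟩ ?_).cons ⟨w, hw, v, hv, hwv, rfl⟩ F.maxRedDegree_le
      · simp [verts_contract hw hwv, hw, hwv]
      · rw [verts_contract hw hwv, Finset.card_erase_of_mem hv, hn]; rfl
    by_cases huniq : ∀ x ∈ Rd, ∀ y ∈ Rd, par x = par y → x = y
    · by_cases hx : ∃ x ∈ H.verts, x ∈ hot ∧ ¬ IsLeafIn H.verts par x
      · obtain ⟨w, hw, v, hv, hwv, mk', Rd', F'⟩ := F.exists_contract huniq hx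
        exact step w hw v hv hwv _ _ _ F'
      · push Not at hx
        have F₁ := F.heat huniq hx
        by_cases hx₁ : ∃ x ∈ H.verts, x ∈ Set.univ ∧ ¬ IsLeafIn H.verts par x
        · obtain ⟨w, hw, v, hv, hwv, mk', Rd', F'⟩ := F₁.exists_contract (F.union_unique huniq hx) hx₁
          exact step w hw v hv hwv _ _ _ F'
        · push Not at hx₁
          have hno : ∀ a b, ¬ H.IsEdge a b := by
            intro a b hab
            rcases F₁.edge a b hab with (h | h) | (h | h)
            · exact hab.ne (hx₁ b hab.mem_right trivial a hab.mem_left h)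
            · exact h.1
            · exact hab.ne (hx₁ a hab.mem_left trivial b hab.mem_right h).symm
            · exact h.1
          refine (hasContractionSequence_zero hH (fun a b h => hno a b (Or.inr h)) ?_).mono
            (by norm_num)
          exact fun f _ h => hno _ _ (Or.inl (h 0 1 (by decide)))
    · push Not at huniq
      obtain ⟨v, hv, w, hw, hvw, hne, hw₀⟩ : ∃ v ∈ Rd, ∃ w ∈ Rd, par v = par w ∧ v ≠ w ∧ w = x₀ := by
        obtain ⟨x, hx, y, hy, hxy, hne⟩ := huniq
        rcases F.rd_unique x hx y hy hxy hne with h | h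
        · exact ⟨y, hy, x, hx, hxy.symm, hne.symm, h⟩
        · exact ⟨x, hx, y, hy, hxy, hne, h⟩
      have hvS := F.rd_mem v hv
      have hwS := F.rd_mem w hw
      refine step w hwS v hvS hne.symm _ _ _ (F.contract hvS hwS hne.symm (F.rd_hot v hv)
        (F.rd_hot w hw) (F.rd_leaf v hv) ((F.rd_leaf w hw).mono (Finset.erase_subset _ _))
        (Or.inl hvw) ?_)
      intro x hx y hy hxv hyv hxy
      by_contra hxy'
      rcases F.rd_unique x hx y hy hxy hxy' with h | h
      · obtain rfl : x = w := h.trans hw₀.symm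
        rcases F.rd_unique v hv y hy (hvw.trans hxy) hyv.symm with h' | h'
        · exact hne (h'.trans hw₀.symm)
        · exact hxy' (h.trans h'.symm)
      · obtain rfl : y = w := h.trans hw₀.symm
        rcases F.rd_unique v hv x hx (hvw.trans hxy.symm) hxv.symm with h' | h'
        · exact hne (h'.trans hw₀.symm)
        · exact hxy' (h'.trans h.symm)

end Trigraph

/-! ### Pseudoforests from excluded paths with two chords -/

/-- No path of `G` has chords at both of its ends, except when the two chords are one edge joining
the ends. Every connected graph with two cycles contains such a path with two distinct chords. -/
def NoBicycle {V : Type*} (G : SimpleGraph V) : Prop :=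
  ∀ (k : ℕ) (f : Fin (k + 1) → V), IsPathSeq G f → ∀ i j : Fin (k + 1), 2 ≤ (i : ℕ) →
    (j : ℕ) + 2 ≤ k → G.Adj (f 0) (f i) → G.Adj (f (Fin.last k)) (f j) → (i : ℕ) = k ∧ (j : ℕ) = 0

section

variable {V : Type*} {G : SimpleGraph V}

theorem IsPathSeq.rev {k : ℕ} {f : Fin k → V} (h : IsPathSeq G f) :
    IsPathSeq G (fun i => f (Fin.rev i)) where
  inj := h.inj.comp Fin.rev_injective
  adj := fun i j hij => (h.adj _ _ (by simp only [Fin.val_rev]; omega)).symm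

/-- Without bicycles, a longest path in a set of minimum degree two closes up to a cycle, and its
first vertex has no further neighbours in the set. -/
theorem NoBicycle.closes_up (hB : NoBicycle G) {S : Finset V}
    (hS : ∀ x ∈ S, ∃ y ∈ S, ∃ z ∈ S, y ≠ z ∧ G.Adj x y ∧ G.Adj x z) {k : ℕ}
    {f : Fin (k + 1) → V} (hf : IsLongestPath G S f) :
    2 ≤ k ∧ G.Adj (f (Fin.last k)) (f 0) ∧
      ∀ y ∈ S, G.Adj (f 0) y → y = f 1 ∨ y = f (Fin.last k) := by
  have two : ∀ g : Fin (k + 1) → V, IsLongestPath G S g →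
      ∃ i : Fin (k + 1), 2 ≤ (i : ℕ) ∧ G.Adj (g 0) (g i) := by
    intro g hg
    obtain ⟨y, hy, z, hz, hyz, h1, h2⟩ := hS (g 0) (hg.mem 0)
    obtain ⟨i, rfl⟩ := hg.exists_of_adj hy h1
    obtain ⟨j, rfl⟩ := hg.exists_of_adj hz h2
    have hi : (i : ℕ) ≠ 0 := fun h => h1.ne (congrArg g (Fin.ext h.symm))
    have hj : (j : ℕ) ≠ 0 := fun h => h2.ne (congrArg g (Fin.ext h.symm))
    have hij : (i : ℕ) ≠ j := fun h => hyz (congrArg g (Fin.ext h))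
    by_cases h : 2 ≤ (i : ℕ)
    · exact ⟨i, h, h1⟩
    · exact ⟨j, by omega, h2⟩
  obtain ⟨i, hi, hadj⟩ := two f hf
  obtain ⟨j, hj, hadj'⟩ := two _ (hf.of_isPathSeq hf.toIsPathSeq.rev fun i => hf.mem _)
  rw [Fin.rev_zero] at hadj'
  have hj' : (Fin.rev j : ℕ) + 2 ≤ k := by rw [Fin.val_rev]; omega
  have h := hB k f hf.toIsPathSeq i (Fin.rev j) hi hj' hadj hadj'
  have h0 : Fin.rev j = 0 := Fin.ext h.2
  rw [h0] at hadj'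
  refine ⟨by omega, hadj', fun y hy hy' => ?_⟩
  obtain ⟨l, rfl⟩ := hf.exists_of_adj hy hy'
  have hl : (l : ℕ) ≠ 0 := fun h => hy'.ne (congrArg f (Fin.ext h.symm))
  by_cases hl2 : 2 ≤ (l : ℕ)
  · refine Or.inr (congrArg f (Fin.ext ?_))
    exact (hB k f hf.toIsPathSeq l 0 hl2 (by simp; omega) hy' hadj').1
  · refine Or.inl (congrArg f (Fin.ext ?_))
    rw [Fin.val_one', Nat.mod_eq_of_lt (by omega)]
    omega

/-- Without bicycles, every set of minimum degree two contains an isolated induced cycle. -/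
theorem NoBicycle.exists_cycle (hB : NoBicycle G) {S : Finset V} (hne : S.Nonempty)
    (hS : ∀ x ∈ S, ∃ y ∈ S, ∃ z ∈ S, y ≠ z ∧ G.Adj x y ∧ G.Adj x z) :
    ∃ (k : ℕ) (f : Fin (k + 1) → V), 2 ≤ k ∧ Function.Injective f ∧ (∀ i, f i ∈ S) ∧
      ∀ i, ∀ y ∈ S, G.Adj (f i) y → y = f (1 + i) ∨ y = f (Fin.last k + i) := by
  obtain ⟨k, f, hf⟩ := exists_isLongestPath G hne
  obtain ⟨hk, hlast, -⟩ := hB.closes_up hS hf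
  refine ⟨k, f, hk, hf.inj, hf.mem, fun c => ?_⟩
  have hcyc : ∀ t : Fin (k + 1), G.Adj (f t) (f (t + 1)) := by
    intro t
    by_cases ht : t = Fin.last k
    · rw [ht, Fin.last_add_one]; exact hlast
    · refine hf.adj t (t + 1) ?_
      rw [Fin.val_add_one, if_neg ht]
  -- Rotating the cycle moves any of its vertices to the front.
  have hrot : IsPathSeq G fun t => f (t + c) := by
    refine ⟨hf.inj.comp (add_left_injective c), fun t s hts => ?_⟩
    have hs : s = t + 1 := by
      have ht : t ≠ Fin.last k := by
        rintro rfl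
        rw [Fin.val_last] at hts
        omega
      refine Fin.ext ?_
      rw [Fin.val_add_one, if_neg ht, hts]
    have := hcyc (t + c)
    rwa [add_right_comm, ← hs] at this
  have := (hB.closes_up hS (hf.of_isPathSeq hrot fun t => hf.mem _)).2.2
  simpa using this

/-! ### Constructing frames -/

theorem Frame.congr {S : Finset V} {par par' rt rt' : V → V} {d d' : V → ℕ} {hot hot' mk : Set V}
    (F : Frame S par rt d hot mk) (hp : ∀ x ∈ S, par' x = par x) (hr : ∀ x ∈ S, rt' x = rt x)
    (hd : ∀ x ∈ S, d' x = d x) (hh : ∀ x ∈ S, x ∈ hot' ↔ x ∈ hot) :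
    Frame S par' rt' d' hot' mk where
  par_mem x hx := by rw [hp x hx]; exact F.par_mem x hx
  lt x hx h := by
    rw [hp x hx] at h ⊢
    rw [hd _ (F.par_mem x hx), hd x hx]
    exact F.lt x hx h
  rt_par x hx := by rw [hp x hx, hr _ (F.par_mem x hx), hr x hx]; exact F.rt_par x hx
  rt_root x hx h := by rw [hp x hx] at h; rw [hr x hx]; exact F.rt_root x hx h
  hot_child x hx h := by
    rw [hp x hx, hh _ (F.par_mem x hx)] at h
    exact (hh x hx).2 (F.hot_child x hx h)
  hot_par x hx h := by
    rw [hp x hx, hh _ (F.par_mem x hx), hr x hx]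
    exact F.hot_par x hx ((hh x hx).1 h)
  mk_mem := F.mk_mem
  mk_hot b hb := (hh b (F.mk_mem b hb)).2 (F.mk_hot b hb)
  rt_mem b hb := by rw [hr b (F.mk_mem b hb)]; exact F.rt_mem b hb
  rt_cold b hb := by
    rw [hr b (F.mk_mem b hb), hh _ (F.rt_mem b hb)]; exact F.rt_cold b hb
  par_rt b hb := by rw [hr b (F.mk_mem b hb), hp _ (F.rt_mem b hb)]; exact F.par_rt b hb
  mk_unique b hb b' hb' h := by
    rw [hr b (F.mk_mem b hb), hr b' (F.mk_mem b' hb')] at h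
    exact F.mk_unique b hb b' hb' h
  hot_unique b hb x hx y hy hxh hyh h1 h2 := by
    rw [hr b (F.mk_mem b hb), hp _ ‹_›] at h1 h2
    exact F.hot_unique b hb x hx y hy ((hh x hx).1 hxh) ((hh y hy).1 hyh) h1 h2

theorem Frame.union [DecidableEq V] {S T : Finset V} {par rt : V → V} {d : V → ℕ}
    {hot mk mk' : Set V} (F : Frame S par rt d hot mk) (F' : Frame T par rt d hot mk')
    (hST : Disjoint S T) : Frame (S ∪ T) par rt d hot (mk ∪ mk') := by
  have hd : ∀ x, x ∈ S → x ∉ T := fun x hx hx' => Finset.disjoint_left.1 hST hx hx'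
  refine ⟨fun x hx => ?_, fun x hx => ?_, fun x hx => ?_, fun x hx => ?_, fun x hx => ?_,
    fun x hx => ?_, fun b hb => ?_, fun b hb => hb.elim (F.mk_hot b) (F'.mk_hot b),
    fun b hb => ?_, fun b hb => hb.elim (F.rt_cold b) (F'.rt_cold b),
    fun b hb => hb.elim (F.par_rt b) (F'.par_rt b), ?_, ?_⟩
  · exact Finset.mem_union.2 ((Finset.mem_union.1 hx).imp (F.par_mem x) (F'.par_mem x))
  · exact (Finset.mem_union.1 hx).elim (F.lt x) (F'.lt x)
  · exact (Finset.mem_union.1 hx).elim (F.rt_par x) (F'.rt_par x)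
  · exact (Finset.mem_union.1 hx).elim (F.rt_root x) (F'.rt_root x)
  · exact (Finset.mem_union.1 hx).elim (F.hot_child x) (F'.hot_child x)
  · exact (Finset.mem_union.1 hx).elim (F.hot_par x) (F'.hot_par x)
  · exact Finset.mem_union.2 (hb.imp (F.mk_mem b) (F'.mk_mem b))
  · exact Finset.mem_union.2 (hb.imp (F.rt_mem b) (F'.rt_mem b))
  · rintro b (hb | hb) b' (hb' | hb') h
    · exact F.mk_unique b hb b' hb' h
    · exact (hd _ (F.rt_mem b hb) (h ▸ F'.rt_mem b' hb')).elim
    · exact (hd _ (F.rt_mem b' hb') (h ▸ F'.rt_mem b hb)).elim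
    · exact F'.mk_unique b hb b' hb' h
  · rintro b (hb | hb) x hx y hy hxh hyh h1 h2
    · have key : ∀ z ∈ S ∪ T, par z = rt b → z ∈ S := fun z hz h =>
        (Finset.mem_union.1 hz).resolve_right fun hzT =>
          hd _ (F.rt_mem b hb) (h ▸ F'.par_mem z hzT)
      exact F.hot_unique b hb x (key x hx h1) y (key y hy h2) hxh hyh h1 h2
    · have key : ∀ z ∈ S ∪ T, par z = rt b → z ∈ T := fun z hz h =>
        (Finset.mem_union.1 hz).resolve_left fun hzS =>
          hd _ (F.par_mem z hzS) (h ▸ F'.rt_mem b hb)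
      exact F'.hot_unique b hb x (key x hx h1) y (key y hy h2) hxh hyh h1 h2

/-- The edges of `G` inside `S` lie in a pseudoforest described by a frame. -/
def HasFrame (G : SimpleGraph V) (S : Finset V) : Prop :=
  ∃ (par rt : V → V) (d : V → ℕ) (hot mk : Set V), Frame S par rt d hot mk ∧
    ∀ x ∈ S, ∀ y ∈ S, G.Adj x y →
      (par x = y ∨ (x ∈ mk ∧ rt x = y)) ∨ (par y = x ∨ (y ∈ mk ∧ rt y = x))

theorem HasFrame.union [DecidableEq V] {S T : Finset V} (hS : HasFrame G S) (hT : HasFrame G T)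
    (hST : Disjoint S T) (hG : ∀ x ∈ S, ∀ y ∈ T, ¬ G.Adj x y) : HasFrame G (S ∪ T) := by
  obtain ⟨par, rt, d, hot, mk, F, hE⟩ := hS
  obtain ⟨par', rt', d', hot', mk', F', hE'⟩ := hT
  have hd : ∀ x, x ∈ T → x ∉ S := fun x hx hx' => Finset.disjoint_left.1 hST hx' hx
  refine ⟨fun x => if x ∈ S then par x else par' x, fun x => if x ∈ S then rt x else rt' x,
    fun x => if x ∈ S then d x else d' x, {x | if x ∈ S then x ∈ hot else x ∈ hot'}, mk ∪ mk',
    (F.congr ?_ ?_ ?_ ?_).union (F'.congr ?_ ?_ ?_ ?_) hST, ?_⟩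
  · exact fun x hx => if_pos hx
  · exact fun x hx => if_pos hx
  · exact fun x hx => if_pos hx
  · exact fun x hx => by simp [hx]
  · exact fun x hx => if_neg (hd x hx)
  · exact fun x hx => if_neg (hd x hx)
  · exact fun x hx => if_neg (hd x hx)
  · exact fun x hx => by simp [hd x hx]
  · intro x hx y hy hxy
    rcases Finset.mem_union.1 hx with hx | hx <;> rcases Finset.mem_union.1 hy with hy | hy
    · have := hE x hx y hy hxy
      simp only [hx, hy, if_true, Set.mem_union]
      tauto
    · exact (hG x hx y hy hxy).elim
    · exact (hG y hy x hx hxy.symm).elim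
    · have := hE' x hx y hy hxy
      simp only [hd x hx, hd y hy, if_false, Set.mem_union]
      tauto

theorem hasFrame_empty (G : SimpleGraph V) : HasFrame G ∅ :=
  ⟨id, id, fun _ => 0, ∅, ∅, by constructor <;> simp, by simp⟩

theorem hasFrame_singleton (G : SimpleGraph V) (x : V) : HasFrame G {x} := by
  refine ⟨id, id, fun _ => 0, ∅, ∅, by constructor <;> simp, ?_⟩
  intro y hy z hz hyz
  rw [Finset.mem_singleton.1 hy, Finset.mem_singleton.1 hz] at hyz
  exact hyz.ne rfl |>.elim

theorem HasFrame.insert_leaf [DecidableEq V] {S : Finset V} (hS : HasFrame G S) {x y : V}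
    (hx : x ∉ S) (hy : y ∈ S) (hxy : ∀ z ∈ S, G.Adj x z → z = y) : HasFrame G (insert x S) := by
  obtain ⟨par, rt, d, hot, mk, F, hE⟩ := hS
  have hne : ∀ z ∈ S, z ≠ x := fun z hz h => hx (h ▸ hz)
  have F' : Frame S (Function.update par x y) (Function.update rt x (rt y))
      (Function.update d x (d y + 1)) {z | if z = x then y ∈ hot else z ∈ hot} mk :=
    F.congr (fun z hz => by simp [hne z hz]) (fun z hz => by simp [hne z hz])
      (fun z hz => by simp [hne z hz]) (fun z hz => by simp [hne z hz])
  have hpx : Function.update par x y x = y := by simp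
  have hrx : Function.update rt x (rt y) x = rt y := by simp
  have hry : Function.update rt x (rt y) y = rt y := by simp [hne y hy]
  have hdx : Function.update d x (d y + 1) x = d y + 1 := by simp
  have hdy : Function.update d x (d y + 1) y = d y := by simp [hne y hy]
  have hhx : x ∈ {z | if z = x then y ∈ hot else z ∈ hot} ↔
      y ∈ {z | if z = x then y ∈ hot else z ∈ hot} := by simp [hne y hy]
  have hEd : ∀ z ∈ S, ∀ w ∈ S, G.Adj z w →
      (Function.update par x y z = w ∨ (z ∈ mk ∧ Function.update rt x (rt y) z = w)) ∨
      (Function.update par x y w = z ∨ (w ∈ mk ∧ Function.update rt x (rt y) w = z)) := by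
    intro z hz w hw hzw
    simpa [hne z hz, hne w hw] using hE z hz w hw hzw
  refine ⟨Function.update par x y, Function.update rt x (rt y), Function.update d x (d y + 1),
    {z | if z = x then y ∈ hot else z ∈ hot}, mk, ?_, ?_⟩
  rotate_left
  · intro z hz w hw hzw
    rcases Finset.mem_insert.1 hz with rfl | hz' <;> rcases Finset.mem_insert.1 hw with rfl | hw'
    · exact (hzw.ne rfl).elim
    · exact Or.inl (Or.inl (hpx.trans (hxy w hw' hzw).symm))
    · exact Or.inr (Or.inl (hpx.trans (hxy z hz' hzw.symm).symm))
    · exact hEd z hz' w hw' hzw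
  · generalize Function.update par x y = p at *
    generalize Function.update rt x (rt y) = r at *
    generalize Function.update d x (d y + 1) = e at *
    generalize {z | if z = x then y ∈ hot else z ∈ hot} = h at *
    have hm : ∀ z ∈ S, z ∈ insert x S := fun z hz => Finset.mem_insert_of_mem hz
    refine ⟨?_, ?_, ?_, ?_, ?_, ?_, fun b hb => hm _ (F'.mk_mem b hb), F'.mk_hot,
      fun b hb => hm _ (F'.rt_mem b hb), F'.rt_cold, F'.par_rt, F'.mk_unique, ?_⟩
    · intro z hz
      rcases Finset.mem_insert.1 hz with rfl | hz
      · rw [hpx]; exact hm _ hy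
      · exact hm _ (F'.par_mem z hz)
    · intro z hz
      rcases Finset.mem_insert.1 hz with rfl | hz
      · intro _; rw [hpx, hdx, hdy]; omega
      · exact F'.lt z hz
    · intro z hz
      rcases Finset.mem_insert.1 hz with rfl | hz
      · rw [hpx, hrx, hry]
      · exact F'.rt_par z hz
    · intro z hz
      rcases Finset.mem_insert.1 hz with rfl | hz
      · intro h'; rw [hpx] at h'; exact (hne y hy h').elim
      · exact F'.rt_root z hz
    · intro z hz
      rcases Finset.mem_insert.1 hz with rfl | hz
      · rw [hpx]; exact hhx.2
      · exact F'.hot_child z hz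
    · intro z hz
      rcases Finset.mem_insert.1 hz with rfl | hz
      · rw [hpx]; exact fun h' => Or.inl (hhx.1 h')
      · exact F'.hot_par z hz
    · intro b hb
      -- A hot new vertex has a hot parent, which is not the root of an additional edge.
      have key : ∀ z ∈ insert x S, z ∈ h → p z = r b → z ∈ S := by
        intro z hz hzh hzb
        rcases Finset.mem_insert.1 hz with rfl | hz
        · rw [hpx] at hzb
          exact (F'.rt_cold b hb (hzb ▸ hhx.1 hzh)).elim
        · exact hz
      exact fun z hz w hw hzh hwh h1 h2 =>
        F'.hot_unique b hb z (key z hz hzh h1) w (key w hw hwh h2) hzh hwh h1 h2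

theorem hasFrame_cycle [DecidableEq V] {k : ℕ} (hk : 2 ≤ k) {f : Fin (k + 1) → V}
    (hf : Function.Injective f)
    (hG : ∀ i j, G.Adj (f i) (f j) → f j = f (1 + i) ∨ f j = f (Fin.last k + i)) :
    HasFrame G (Finset.univ.image f) := by
  set g : V → Fin (k + 1) := Function.invFun f with hgdef
  have hg : ∀ i, g (f i) = i := Function.leftInverse_invFun hf
  -- The predecessor on the cycle, cut open at `f 0`, which becomes the root.
  let p : Fin (k + 1) → Fin (k + 1) := fun i => ⟨i - 1, by omega⟩
  have hp : ∀ i, ((p i : Fin (k + 1)) : ℕ) = i - 1 := fun i => rfl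
  have hp0 : ∀ i, p i = 0 → (i : ℕ) ≤ 1 := fun i hi => by
    have := congrArg Fin.val hi
    rw [hp] at this
    simp at this
    omega
  have hsucc : ∀ i, i ≠ Fin.last k → p (1 + i) = i := fun i hi => Fin.ext (by
    rw [hp, add_comm 1 i, Fin.val_add_one, if_neg hi]; rfl)
  refine ⟨fun x => f (p (g x)), fun _ => f 0, fun x => g x, {x | g x ≠ 0}, {f (Fin.last k)},
    ?_, ?_⟩
  · have hmem : ∀ i, f i ∈ Finset.univ.image f := fun i => Finset.mem_image_of_mem f (by simp)
    refine ⟨?_, ?_, ?_, ?_, ?_, ?_, ?_, ?_, ?_, ?_, ?_, ?_, ?_⟩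
    · exact fun x _ => hmem _
    · simp only [Finset.mem_image, Finset.mem_univ, true_and, forall_exists_index,
        forall_apply_eq_imp_iff, hg]
      intro i hi
      have : (i : ℕ) ≠ 0 := fun h => hi (congrArg f (Fin.ext (by rw [hp, h])))
      rw [hp]; omega
    · exact fun _ _ => rfl
    · simp only [Finset.mem_image, Finset.mem_univ, true_and, forall_exists_index,
        forall_apply_eq_imp_iff, hg]
      intro i hi
      have := congrArg Fin.val (hf hi)
      rw [hp] at this
      exact congrArg f (Fin.ext (by simp; omega))
    · simp only [Finset.mem_image, Finset.mem_univ, true_and, forall_exists_index,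
        forall_apply_eq_imp_iff, Set.mem_ofPred_eq, hg]
      intro i hi h
      exact hi (Fin.ext (by rw [hp, h]; rfl))
    · intro x _ _
      by_cases h : p (g x) = 0
      · exact Or.inr (congrArg f h)
      · exact Or.inl (by simpa [hg] using h)
    · rintro b rfl; exact hmem _
    · rintro b rfl
      simp only [Set.mem_ofPred_eq, hg]
      intro h
      have := congrArg Fin.val h
      simp at this
      omega
    · exact fun _ _ => hmem _
    · rintro b -; simp [hg]
    · rintro b -; simp only [hg]; rfl
    · rintro b rfl b' rfl _; rfl
    · simp only [Finset.mem_image, Finset.mem_univ, true_and, forall_exists_index,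
        forall_apply_eq_imp_iff, Set.mem_ofPred_eq, hg]
      intro b _ i j hi hj h1 h2
      have h1 := hp0 i (hf h1)
      have h2 := hp0 j (hf h2)
      have hi : (i : ℕ) ≠ 0 := fun h => hi (Fin.ext h)
      have hj : (j : ℕ) ≠ 0 := fun h => hj (Fin.ext h)
      exact congrArg f (Fin.ext (by omega))
  · simp only [Finset.mem_image, Finset.mem_univ, true_and, forall_exists_index,
      forall_apply_eq_imp_iff, hg, Set.mem_singleton_iff]
    intro i j hij
    rcases hG i j hij with h | h
    · obtain rfl := hf h
      by_cases hi : i = Fin.last k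
      · refine Or.inl (Or.inr ⟨by rw [hi], ?_⟩)
        rw [hi, add_comm 1 (Fin.last k), Fin.last_add_one]
      · exact Or.inr (Or.inl (by rw [hsucc i hi]))
    · have hji : i = 1 + j := by
        rw [hf h, ← add_assoc, add_comm 1 (Fin.last k), Fin.last_add_one, zero_add]
      obtain rfl := hji
      by_cases hj : j = Fin.last k
      · refine Or.inr (Or.inr ⟨by rw [hj], ?_⟩)
        rw [hj, add_comm 1 (Fin.last k), Fin.last_add_one]
      · exact Or.inl (Or.inl (by rw [hsucc j hj]))

/-- Peel off vertices of degree at most one, then split off cycles. -/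
theorem NoBicycle.hasFrame [DecidableEq V] (hB : NoBicycle G) (S : Finset V) : HasFrame G S := by
  induction S using Finset.strongInduction with
  | H S ih =>
    by_cases hS : ∀ x ∈ S, ∃ y ∈ S, ∃ z ∈ S, y ≠ z ∧ G.Adj x y ∧ G.Adj x z
    · rcases S.eq_empty_or_nonempty with rfl | hne
      · exact hasFrame_empty G
      obtain ⟨k, f, hk, hf, hfS, hG⟩ := hB.exists_cycle hne hS
      have hsub : Finset.univ.image f ⊆ S := by
        intro x hx
        obtain ⟨i, -, rfl⟩ := Finset.mem_image.1 hx
        exact hfS i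
      have hlt : S \ Finset.univ.image f ⊂ S :=
        Finset.sdiff_ssubset hsub ⟨f 0, Finset.mem_image_of_mem f (by simp)⟩
      have := (hasFrame_cycle (G := G) hk hf fun i j => hG i _ (hfS j)).union (ih _ hlt)
        Finset.disjoint_sdiff ?_
      · rwa [Finset.union_sdiff_of_subset hsub] at this
      · intro x hx y hy hxy
        obtain ⟨i, -, rfl⟩ := Finset.mem_image.1 hx
        obtain ⟨hy, hy'⟩ := Finset.mem_sdiff.1 hy
        refine hy' ?_
        rcases hG i y hy hxy with rfl | rfl <;> exact Finset.mem_image_of_mem f (by simp)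
    · push Not at hS
      obtain ⟨x, hx, hdeg⟩ := hS
      have hx' : x ∉ S.erase x := by simp
      have hF := ih _ (Finset.erase_ssubset hx)
      rw [← Finset.insert_erase hx]
      by_cases hy : ∃ y ∈ S, G.Adj x y
      · obtain ⟨y, hy, hxy⟩ := hy
        refine hF.insert_leaf hx' (Finset.mem_erase.2 ⟨hxy.ne.symm, hy⟩) fun z hz hxz => ?_
        by_contra hzy
        exact hdeg z (Finset.mem_of_mem_erase hz) y hy hzy hxz hxy
      · push Not at hy
        rw [Finset.insert_eq]
        refine (hasFrame_singleton G x).union hF (by simp) fun a ha b hb => ?_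
        rw [Finset.mem_singleton.1 ha]
        exact hy b (Finset.mem_of_mem_erase hb)

end

theorem Trigraph.hasContractionSequence_two {V : Type*} [DecidableEq V] [Fintype V] [Nonempty V]
    {G : SimpleGraph V} (hB : NoBicycle G) : (ofGraph G).HasContractionSequence 2 := by
  obtain ⟨par, rt, d, hot, mk, F, hE⟩ := hB.hasFrame Finset.univ
  have F' : Framed (ofGraph G) par rt d hot mk ∅ (Classical.arbitrary V) :=
    ⟨F, fun x y h => h.elim (hE x (by simp) y (by simp)) fun h => h.elim, fun x y h => h.elim,
      fun _ h => h.elim, fun _ h => h.elim, fun _ h => h.elim, fun _ h => h.elim,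
      fun _ h => h.elim⟩
  exact F'.hasContractionSequence_two Finset.univ_nonempty

/-! ### Containment probabilities in the binomial random graph -/

section Probability

open MeasureTheory ProbabilityTheory unitInterval

instance SimpleGraph.instMeasurableSingletonClass {V : Type*} [Countable V] :
    MeasurableSingletonClass (SimpleGraph V) where
  measurableSet_singleton G := by
    rw [← SimpleGraph.measurableEmbedding_edgeSet.measurableSet_image, Set.image_singleton]
    exact measurableSet_singleton _

/-- The event that all pairs in `T` are edges. -/
def containsEdges {V : Type*} (T : Finset (Sym2 V)) : Set (SimpleGraph V) :=
  {G | ∀ e ∈ T, e ∈ G.edgeSet}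

theorem containsEdges_inter {V : Type*} [DecidableEq V] (S T : Finset (Sym2 V)) :
    containsEdges S ∩ containsEdges T = containsEdges (S ∪ T) := by
  ext G
  simp only [containsEdges, Set.mem_inter_iff, Set.mem_ofPred_eq, Finset.mem_union]
  exact ⟨fun h e he => he.elim (h.1 e) (h.2 e), fun h => ⟨fun e he => h e (Or.inl he),
    fun e he => h e (Or.inr he)⟩⟩

theorem measureReal_containsEdges {V : Type*} [Finite V] (p : I) {T : Finset (Sym2 V)}
    (hT : ∀ e ∈ T, ¬ e.IsDiag) :
    (SimpleGraph.binomialRandom V p).real (containsEdges T) = (p : ℝ) ^ T.card := by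
  have h1 : SimpleGraph.fromEdgeSet ⁻¹' containsEdges T =
      {s : Set (Sym2 V) | ∀ e ∈ T, e ∈ s} := by
    ext s
    simp only [containsEdges, Set.mem_preimage, Set.mem_ofPred_eq, SimpleGraph.edgeSet_fromEdgeSet]
    exact ⟨fun h e he => (h e he).1, fun h e he => ⟨h e he, hT e he⟩⟩
  have h2 : (fun q : Sym2 V → Prop => {e | q e}) ⁻¹' {s : Set (Sym2 V) | ∀ e ∈ T, e ∈ s} =
      Set.pi (T : Set (Sym2 V)) fun _ => {True} := by
    ext q
    simp [Set.mem_pi]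
  rw [measureReal_def, SimpleGraph.binomialRandom_eq_map,
    Measure.map_apply SimpleGraph.measurable_fromEdgeSet (Set.toFinite _).measurableSet, h1,
    setBernoulli_apply', h2, Measure.infinitePi_pi _ (fun _ _ => measurableSet_singleton _)]
  rw [Finset.prod_congr rfl (g := fun _ => (toNNReal p : ENNReal))]
  · simp
  · intro e he
    have := hT e he
    simp [this]

theorem measureReal_containsEdges_le {V : Type*} [Finite V] (p : I) (T : Finset (Sym2 V)) :
    (SimpleGraph.binomialRandom V p).real (containsEdges T) ≤ (p : ℝ) ^ T.card := by
  by_cases hT : ∀ e ∈ T, ¬ e.IsDiag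
  · exact (measureReal_containsEdges p hT).le
  · push Not at hT
    obtain ⟨e, he, hd⟩ := hT
    have : containsEdges T = ∅ :=
      Set.eq_empty_iff_forall_notMem.2 fun G hG => G.not_isDiag_of_mem_edgeSet (hG e he) hd
    rw [this, measureReal_empty]
    exact pow_nonneg p.2.1 _

/-- First moment bound: the expected number of copies of a pattern bounds the probability that it
occurs. -/
theorem measureReal_exists_copy_le (n : ℕ) (p : I) {k : ℕ} (E : Finset (Sym2 (Fin k))) :
    (SimpleGraph.binomialRandom (Fin n) p).real
      {G | ∃ f : Fin k → Fin n, Function.Injective f ∧ ∀ e ∈ E, Sym2.map f e ∈ G.edgeSet} ≤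
    (n : ℝ) ^ k * (p : ℝ) ^ E.card := by
  classical
  set F : Finset (Fin k → Fin n) := {f | Function.Injective f} with hF
  have h1 : {G : SimpleGraph (Fin n) | ∃ f : Fin k → Fin n, Function.Injective f ∧
      ∀ e ∈ E, Sym2.map f e ∈ G.edgeSet} ⊆ ⋃ f ∈ F, containsEdges (E.image (Sym2.map f)) := by
    rintro G ⟨f, hf, hG⟩
    simp only [Set.mem_iUnion]
    exact ⟨f, by simp [hF, hf], by simpa [containsEdges] using hG⟩
  refine (measureReal_mono h1 (measure_ne_top _ _)).trans ((measureReal_biUnion_finset_le _ _).trans ?_)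
  refine (Finset.sum_le_card_nsmul F _ ((p : ℝ) ^ E.card) fun f hf => ?_).trans ?_
  · refine (measureReal_containsEdges_le p _).trans_eq ?_
    rw [Finset.card_image_of_injective _ (Sym2.map.injective (by simpa [hF] using hf))]
  · rw [nsmul_eq_mul]
    refine mul_le_mul_of_nonneg_right ?_ (pow_nonneg p.2.1 _)
    have : F.card ≤ n ^ k := by
      simpa using Finset.card_filter_le (s := Finset.univ) (p := fun f : Fin k → Fin n =>
        Function.Injective f)
    exact_mod_cast this

/-! ### The second moment method for trees -/

variable {m : ℕ} {par : Fin (m + 1) → Fin (m + 1)}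

/-- The edges of the copy, placed at `f`, of the tree with root `0` in which every other vertex `i`
has the parent `par i`. -/
noncomputable def copyEdges {V : Type*} (par : Fin (m + 1) → Fin (m + 1)) (f : Fin (m + 1) → V) :
    Finset (Sym2 V) := by
  classical exact (Finset.univ.filter (· ≠ 0)).image fun i => s(f i, f (par i))

theorem mem_copyEdges {V : Type*} {f : Fin (m + 1) → V} {e : Sym2 V} :
    e ∈ copyEdges par f ↔ ∃ i, i ≠ 0 ∧ s(f i, f (par i)) = e := by
  simp [copyEdges]

theorem copyEdges_injOn {V : Type*} {f : Fin (m + 1) → V} (hf : Function.Injective f)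
    (hpar : ∀ i, i ≠ 0 → par i < i) : Set.InjOn (fun i => s(f i, f (par i))) {i | i ≠ 0} := by
  intro i hi j hj hij
  simp only [Sym2.eq_iff] at hij
  rcases hij with h | h
  · exact hf h.1
  · have h1 := hf h.1
    have h2 := hf h.2
    have h3 := hpar i hi
    have h4 := hpar j hj
    rw [← h1] at h4
    rw [h2] at h3
    exact absurd h4 (not_lt.2 h3.le)

theorem card_copyEdges {V : Type*} {f : Fin (m + 1) → V} (hf : Function.Injective f)
    (hpar : ∀ i, i ≠ 0 → par i < i) : (copyEdges par f).card = m := by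
  classical
  rw [copyEdges, Finset.card_image_of_injOn (fun i hi j hj => copyEdges_injOn hf hpar
    (by simpa using hi) (by simpa using hj)), Finset.filter_ne']
  simp

theorem not_isDiag_copyEdges {V : Type*} {f : Fin (m + 1) → V} (hf : Function.Injective f)
    (hpar : ∀ i, i ≠ 0 → par i < i) : ∀ e ∈ copyEdges par f, ¬ e.IsDiag := by
  intro e he
  obtain ⟨i, hi, rfl⟩ := mem_copyEdges.1 he
  rw [Sym2.mk_isDiag_iff]
  exact fun h => (hpar i hi).ne (hf h).symm

/-- Two copies of a tree that share the vertices with indices in `J` share less than `|J|` edges: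
distinct common edges have distinct lower ends, and the lowest index in `J` is not among them. -/
theorem card_copyEdges_inter {V : Type*} [DecidableEq V] {f g : Fin (m + 1) → V}
    {J : Finset (Fin (m + 1))}
    (hJ : ∀ i, i ∈ J ↔ ∃ j, f j = g i) (hpar : ∀ i, i ≠ 0 → par i < i) :
    (copyEdges par f ∩ copyEdges par g).card ≤ J.card - 1 := by
  classical
  have hsub : copyEdges par f ∩ copyEdges par g ⊆
      (J.filter fun i => i ≠ 0 ∧ par i ∈ J).image fun i => s(g i, g (par i)) := by
    intro e he
    obtain ⟨he, he'⟩ := Finset.mem_inter.1 he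
    obtain ⟨i, hi, rfl⟩ := mem_copyEdges.1 he'
    obtain ⟨j, hj, hji⟩ := mem_copyEdges.1 he
    refine Finset.mem_image.2 ⟨i, Finset.mem_filter.2 ⟨?_, hi, ?_⟩, rfl⟩
    · rw [hJ]
      rcases Sym2.eq_iff.1 hji with h | h
      · exact ⟨_, h.1⟩
      · exact ⟨_, h.2⟩
    · rw [hJ]
      rcases Sym2.eq_iff.1 hji with h | h
      · exact ⟨_, h.2⟩
      · exact ⟨_, h.1⟩
  refine (Finset.card_le_card hsub).trans (Finset.card_image_le.trans ?_)
  rcases J.eq_empty_or_nonempty with rfl | hne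
  · simp
  · rw [← Finset.card_erase_of_mem (J.min'_mem hne)]
    refine Finset.card_le_card fun i hi => ?_
    obtain ⟨hiJ, hi0, hp⟩ := Finset.mem_filter.1 hi
    refine Finset.mem_erase.2 ⟨?_, hiJ⟩
    rintro rfl
    exact absurd (hpar _ hi0) (not_lt.2 (J.min'_le _ hp))

/-- The placements of a tree with `m` edges, that is, the injections of its `m + 1` vertices. -/
noncomputable def placements (n m : ℕ) : Finset (Fin (m + 1) → Fin n) := by
  classical exact Finset.univ.filter Function.Injective

theorem mem_placements {n m : ℕ} {f : Fin (m + 1) → Fin n} :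
    f ∈ placements n m ↔ Function.Injective f := by
  simp [placements]

theorem card_placements (n m : ℕ) : (placements n m).card = n.descFactorial (m + 1) := by
  classical
  have h := Fintype.card_embedding_eq (α := Fin (m + 1)) (β := Fin n)
  rw [Fintype.card_fin, Fintype.card_fin] at h
  rw [← h, placements, ← Fintype.card_subtype]
  exact Fintype.card_congr (Equiv.subtypeInjectiveEquivEmbedding _ _)

/-- The number of copies of the tree in `G`, counted as labelled placements. -/
noncomputable def copyCount (n : ℕ) (par : Fin (m + 1) → Fin (m + 1)) (G : SimpleGraph (Fin n)) :
    ℝ :=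
  ∑ f ∈ placements n m, (containsEdges (copyEdges par f)).indicator 1 G

theorem integral_copyCount (n : ℕ) (p : I) (hpar : ∀ i, i ≠ 0 → par i < i) :
    ∫ G, copyCount n par G ∂(SimpleGraph.binomialRandom (Fin n) p) =
      (placements n m).card * (p : ℝ) ^ m := by
  unfold copyCount
  rw [integral_finsetSum _ fun _ _ => Integrable.of_finite, Finset.sum_congr rfl
    (g := fun _ => (p : ℝ) ^ m)]
  · simp
  · intro f hf
    rw [integral_indicator_one (Set.toFinite _).measurableSet, measureReal_containsEdges p
      (not_isDiag_copyEdges (mem_placements.1 hf) hpar),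
      card_copyEdges (mem_placements.1 hf) hpar]

theorem integral_copyCount_sq (n : ℕ) (p : I) (hpar : ∀ i, i ≠ 0 → par i < i) :
    ∫ G, (copyCount n par G) ^ 2 ∂(SimpleGraph.binomialRandom (Fin n) p) =
      ∑ f ∈ placements n m, ∑ g ∈ placements n m,
        (p : ℝ) ^ (copyEdges par f ∪ copyEdges par g).card := by
  have h : ∀ G : SimpleGraph (Fin n), (copyCount n par G) ^ 2 =
      ∑ f ∈ placements n m, ∑ g ∈ placements n m,
        (containsEdges (copyEdges par f ∪ copyEdges par g)).indicator 1 G := by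
    intro G
    rw [sq, copyCount, Finset.sum_mul_sum]
    refine Finset.sum_congr rfl fun f _ => Finset.sum_congr rfl fun g _ => ?_
    rw [← containsEdges_inter, Set.inter_indicator_one, Pi.mul_apply]
  simp_rw [h]
  rw [integral_finsetSum _ fun _ _ => Integrable.of_finite]
  refine Finset.sum_congr rfl fun f hf => ?_
  rw [integral_finsetSum _ fun _ _ => Integrable.of_finite]
  refine Finset.sum_congr rfl fun g hg => ?_
  rw [integral_indicator_one (Set.toFinite _).measurableSet, measureReal_containsEdges p]
  intro e he
  exact (Finset.mem_union.1 he).elim (not_isDiag_copyEdges (mem_placements.1 hf) hpar e)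
    (not_isDiag_copyEdges (mem_placements.1 hg) hpar e)

/-- The variance of the number of copies, grouped by the set `J` of indices of shared vertices. -/
theorem variance_copyCount_le (n : ℕ) (p : I) (hpar : ∀ i, i ≠ 0 → par i < i) :
    variance (copyCount n par) (SimpleGraph.binomialRandom (Fin n) p) ≤
      (placements n m).card * ∑ J ∈ (Finset.univ : Finset (Finset (Fin (m + 1)))).erase ∅,
        ((m + 1 : ℕ) : ℝ) ^ J.card * (n : ℝ) ^ (m + 1 - J.card) *
          (p : ℝ) ^ (2 * m + 1 - J.card) := by
  classical
  have hp0 : (0 : ℝ) ≤ p := p.2.1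
  have hp1 : (p : ℝ) ≤ 1 := p.2.2
  rw [variance_eq_sub MemLp.of_discrete, integral_copyCount n p hpar]
  simp only [Pi.pow_apply]
  rw [integral_copyCount_sq n p hpar]
  have hsq : ((placements n m).card * (p : ℝ) ^ m) ^ 2 =
      ∑ f ∈ placements n m, ∑ g ∈ placements n m, (p : ℝ) ^ (2 * m) := by
    simp only [Finset.sum_const, nsmul_eq_mul]
    ring
  rw [hsq, ← Finset.sum_sub_distrib, ← nsmul_eq_mul]
  refine Finset.sum_le_card_nsmul _ _ _ fun f hf => ?_
  rw [← Finset.sum_sub_distrib]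
  have hf := mem_placements.1 hf
  have hterm : ∀ g ∈ placements n m,
      (p : ℝ) ^ (copyEdges par f ∪ copyEdges par g).card - (p : ℝ) ^ (2 * m) ≤
      ∑ J ∈ (Finset.univ : Finset (Finset (Fin (m + 1)))).erase ∅,
        if ∀ i ∈ J, g i ∈ Finset.univ.image f then (p : ℝ) ^ (2 * m + 1 - J.card) else 0 := by
    intro g hg
    have hg := mem_placements.1 hg
    set J : Finset (Fin (m + 1)) := {i | ∃ j, f j = g i} with hJdef
    have hJ : ∀ i, i ∈ J ↔ ∃ j, f j = g i := fun i => by simp [hJdef]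
    have hcard := card_copyEdges_inter hJ hpar
    have hunion := Finset.card_union_add_card_inter (copyEdges par f) (copyEdges par g)
    rw [card_copyEdges hf hpar, card_copyEdges hg hpar] at hunion
    by_cases hJe : J = ∅
    · rw [hJe] at hcard
      have : (copyEdges par f ∪ copyEdges par g).card = 2 * m := by
        rw [Finset.card_empty] at hcard; omega
      rw [this, sub_self]
      exact Finset.sum_nonneg fun J _ => by split_ifs <;> positivity
    · have hJ1 : 1 ≤ J.card := Finset.card_pos.2 (Finset.nonempty_iff_ne_empty.2 hJe)
      refine (sub_le_self _ (by positivity)).trans ?_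
      refine le_trans ?_ (Finset.single_le_sum (f := fun J : Finset (Fin (m + 1)) =>
        if ∀ i ∈ J, g i ∈ Finset.univ.image f then (p : ℝ) ^ (2 * m + 1 - J.card) else 0)
        (fun J _ => by split_ifs <;> positivity)
        (Finset.mem_erase.2 ⟨hJe, Finset.mem_univ J⟩))
      rw [if_pos fun i hi => by simpa using (hJ i).1 hi]
      exact pow_le_pow_of_le_one hp0 hp1 (by omega)
  refine (Finset.sum_le_sum hterm).trans ?_
  rw [Finset.sum_comm]
  refine Finset.sum_le_sum fun J _ => ?_
  rw [← Finset.sum_filter, Finset.sum_const, nsmul_eq_mul]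
  refine mul_le_mul_of_nonneg_right ?_ (by positivity)
  -- A placement `g` maps the indices in `J` to the `m + 1` vertices of `f`, the others anywhere.
  have hsub : (placements n m).filter (fun g => ∀ i ∈ J, g i ∈ Finset.univ.image f) ⊆
      Fintype.piFinset fun i => if i ∈ J then Finset.univ.image f else Finset.univ := by
    intro g hg
    rw [Fintype.mem_piFinset]
    intro i
    split_ifs with hi
    · exact (Finset.mem_filter.1 hg).2 i hi
    · exact Finset.mem_univ _
  have hc := Finset.card_le_card hsub
  rw [Fintype.card_piFinset] at hc
  have hprod : ∏ i : Fin (m + 1), (if i ∈ J then Finset.univ.image f else Finset.univ).card =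
      (m + 1) ^ J.card * n ^ (m + 1 - J.card) := by
    have : ∀ i : Fin (m + 1), (if i ∈ J then Finset.univ.image f else Finset.univ).card =
        if i ∈ J then m + 1 else n := by
      intro i
      split_ifs
      · rw [Finset.card_image_of_injective _ hf]; simp
      · simp
    simp_rw [this]
    rw [Finset.prod_ite, Finset.prod_const, Finset.prod_const]
    congr 2
    · simp
    · rw [Finset.filter_not, Finset.card_sdiff_of_subset (Finset.filter_subset _ _)]
      simp
  rw [hprod] at hc
  exact_mod_cast hc

theorem min_le_mul_pow {a x : ℝ} (hx : 0 ≤ x) (ha : 0 ≤ a) {j m : ℕ} (hj : j ≤ m) :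
    min x (x * a ^ m) ≤ x * a ^ j := by
  rcases le_total 1 a with h | h
  · exact (min_le_left _ _).trans (le_mul_of_one_le_right hx (one_le_pow₀ h))
  · exact (min_le_right _ _).trans
      (mul_le_mul_of_nonneg_left (pow_le_pow_of_le_one ha h hj) hx)

theorem variance_copyCount_mul_le (n : ℕ) (p : I) (hpar : ∀ i, i ≠ 0 → par i < i)
    (hn : 2 * (m + 1) ≤ n) :
    variance (copyCount n par) (SimpleGraph.binomialRandom (Fin n) p) *
        min (n : ℝ) (n * (n * p) ^ m) ≤
      (4 * (m + 1)) ^ (m + 1) * ((placements n m).card * (p : ℝ) ^ m) ^ 2 := by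
  have hp0 : (0 : ℝ) ≤ p := p.2.1
  have hn0 : (0 : ℝ) ≤ n := Nat.cast_nonneg n
  set M := min (n : ℝ) (n * (n * p) ^ m) with hM
  have hM0 : 0 ≤ M := le_min hn0 (by positivity)
  obtain ⟨N, hN⟩ : ∃ N : ℝ, N = ((placements n m).card : ℝ) := ⟨_, rfl⟩
  rw [← hN]
  have hterm : ∀ J ∈ (Finset.univ : Finset (Finset (Fin (m + 1)))).erase ∅,
      ((m + 1 : ℕ) : ℝ) ^ J.card * (n : ℝ) ^ (m + 1 - J.card) *
        (p : ℝ) ^ (2 * m + 1 - J.card) * M ≤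
      ((m + 1 : ℕ) : ℝ) ^ (m + 1) * (n ^ (m + 1) * (p : ℝ) ^ (2 * m)) := by
    intro J hJ
    have hJ1 : 1 ≤ J.card :=
      Finset.card_pos.2 (Finset.nonempty_iff_ne_empty.2 (Finset.ne_of_mem_erase hJ))
    have hJ2 : J.card ≤ m + 1 := by simpa using Finset.card_le_univ J
    obtain ⟨j, hj⟩ : ∃ j, J.card = j + 1 := ⟨J.card - 1, by omega⟩
    obtain ⟨r, hr⟩ : ∃ r, m = j + r := ⟨m - j, by omega⟩
    have h1 : M ≤ n * (n * p) ^ j := min_le_mul_pow hn0 (by positivity) (by omega)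
    have h2 : ((m + 1 : ℕ) : ℝ) ^ J.card ≤ ((m + 1 : ℕ) : ℝ) ^ (m + 1) :=
      pow_le_pow_right₀ (by push_cast; linarith [Nat.cast_nonneg (α := ℝ) m]) hJ2
    have h3 : (n : ℝ) ^ (m + 1 - J.card) * (p : ℝ) ^ (2 * m + 1 - J.card) * (n * (n * p) ^ j) =
        n ^ (m + 1) * (p : ℝ) ^ (2 * m) := by
      have e1 : m + 1 - J.card = r := by omega
      have e2 : 2 * m + 1 - J.card = j + 2 * r := by omega
      rw [e1, e2, hr]
      ring
    rw [mul_assoc, mul_assoc]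
    refine mul_le_mul h2 ?_ (by positivity) (by positivity)
    rw [← h3, ← mul_assoc]
    exact mul_le_mul_of_nonneg_left h1 (by positivity)
  have hsum : (∑ J ∈ (Finset.univ : Finset (Finset (Fin (m + 1)))).erase ∅,
      ((m + 1 : ℕ) : ℝ) ^ J.card * (n : ℝ) ^ (m + 1 - J.card) *
        (p : ℝ) ^ (2 * m + 1 - J.card)) * M ≤
      2 ^ (m + 1) * (((m + 1 : ℕ) : ℝ) ^ (m + 1) * (n ^ (m + 1) * (p : ℝ) ^ (2 * m))) := by
    rw [Finset.sum_mul]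
    refine (Finset.sum_le_card_nsmul _ _ _ hterm).trans ?_
    rw [nsmul_eq_mul]
    refine mul_le_mul_of_nonneg_right ?_ (by positivity)
    have : ((Finset.univ : Finset (Finset (Fin (m + 1)))).erase ∅).card ≤ 2 ^ (m + 1) := by
      refine (Finset.card_le_card (Finset.erase_subset _ _)).trans_eq ?_
      simp
    exact_mod_cast this
  -- The falling factorial is at least `(n / 2) ^ (m + 1)`.
  have hNn : (n : ℝ) ^ (m + 1) ≤ 2 ^ (m + 1) * N := by
    have h1 : n ^ (m + 1) ≤ 2 ^ (m + 1) * n.descFactorial (m + 1) := by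
      refine le_trans ?_ (Nat.mul_le_mul_left _ (Nat.pow_sub_le_descFactorial n (m + 1)))
      rw [← mul_pow]
      exact Nat.pow_le_pow_left (by omega) _
    rw [hN, card_placements]
    exact_mod_cast h1
  have hN0 : 0 ≤ N := hN ▸ Nat.cast_nonneg _
  calc _ ≤ N * (∑ J ∈ (Finset.univ : Finset (Finset (Fin (m + 1)))).erase ∅,
      ((m + 1 : ℕ) : ℝ) ^ J.card * (n : ℝ) ^ (m + 1 - J.card) *
        (p : ℝ) ^ (2 * m + 1 - J.card)) * M :=
        mul_le_mul_of_nonneg_right (hN ▸ variance_copyCount_le n p hpar) hM0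
    _ ≤ N * (2 ^ (m + 1) * (((m + 1 : ℕ) : ℝ) ^ (m + 1) *
          ((2 ^ (m + 1) * N) * (p : ℝ) ^ (2 * m)))) := by
        rw [mul_assoc]
        refine mul_le_mul_of_nonneg_left (hsum.trans ?_) hN0
        gcongr
    _ = _ := by
        have : (4 : ℝ) = 2 * 2 := by norm_num
        rw [this, mul_pow, mul_pow]
        push_cast
        ring

/-- The number of copies of the tree together with a further edge between vertices of the copy. -/
noncomputable def chordCount (n : ℕ) (par : Fin (m + 1) → Fin (m + 1)) (G : SimpleGraph (Fin n)) :
    ℝ :=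
  ∑ f ∈ placements n m, ∑ x : Fin (m + 1) × Fin (m + 1) with
    x.1 ≠ x.2 ∧ ¬ (parentGraph par).Adj x.1 x.2,
    (containsEdges (insert s(f x.1, f x.2) (copyEdges par f))).indicator 1 G

theorem chordCount_nonneg (n : ℕ) (G : SimpleGraph (Fin n)) : 0 ≤ chordCount n par G :=
  Finset.sum_nonneg fun _ _ => Finset.sum_nonneg fun _ _ =>
    Set.indicator_nonneg (fun _ _ => zero_le_one) _

theorem integral_chordCount_le (n : ℕ) (p : I) (hpar : ∀ i, i ≠ 0 → par i < i) :
    ∫ G, chordCount n par G ∂(SimpleGraph.binomialRandom (Fin n) p) ≤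
      (placements n m).card * ((m + 1) ^ 2 * (p : ℝ) ^ (m + 1)) := by
  unfold chordCount
  rw [integral_finsetSum _ fun _ _ => Integrable.of_finite, ← nsmul_eq_mul]
  refine Finset.sum_le_card_nsmul _ _ _ fun f hf => ?_
  have hf := mem_placements.1 hf
  rw [integral_finsetSum _ fun _ _ => Integrable.of_finite]
  refine (Finset.sum_le_card_nsmul _ _ ((p : ℝ) ^ (m + 1)) fun x hx => ?_).trans ?_
  · rw [integral_indicator_one (Set.toFinite _).measurableSet]
    refine (measureReal_containsEdges_le p _).trans_eq ?_
    obtain ⟨-, hne, hadj⟩ := Finset.mem_filter.1 hx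
    rw [Finset.card_insert_of_notMem, card_copyEdges hf hpar]
    intro hmem
    obtain ⟨i, hi, he⟩ := mem_copyEdges.1 hmem
    rcases Sym2.eq_iff.1 he with h | h
    · exact hadj ⟨hne, Or.inl (by rw [← hf h.1, hf h.2])⟩
    · exact hadj ⟨hne, Or.inr (by rw [← hf h.1, hf h.2])⟩
  · rw [nsmul_eq_mul]
    refine mul_le_mul_of_nonneg_right ?_ (pow_nonneg p.2.1 _)
    have h := Finset.card_filter_le (s := Finset.univ)
      (p := fun x : Fin (m + 1) × Fin (m + 1) => x.1 ≠ x.2 ∧ ¬ (parentGraph par).Adj x.1 x.2)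
    rw [Finset.card_univ, Fintype.card_prod, Fintype.card_fin, ← sq] at h
    exact_mod_cast h

/-- If there are more copies of the tree than copies with a further edge, then some copy is
induced. -/
theorem exists_induced_copy (h0 : par 0 = 0) {n : ℕ}
    {G : SimpleGraph (Fin n)} (h : chordCount n par G < copyCount n par G) :
    ∃ f : Fin (m + 1) → Fin n, Function.Injective f ∧
      ∀ i j, G.Adj (f i) (f j) ↔ (parentGraph par).Adj i j := by
  obtain ⟨f, hf, hlt⟩ := Finset.exists_lt_of_sum_lt h
  have hnn : ∀ x ∈ Finset.univ.filter fun x : Fin (m + 1) × Fin (m + 1) =>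
      x.1 ≠ x.2 ∧ ¬ (parentGraph par).Adj x.1 x.2,
      (0 : ℝ) ≤ (containsEdges (insert s(f x.1, f x.2) (copyEdges par f))).indicator 1 G :=
    fun x _ => Set.indicator_nonneg (fun _ _ => zero_le_one) _
  have hG : G ∈ containsEdges (copyEdges par f) := by
    by_contra hG
    rw [Set.indicator_of_notMem hG] at hlt
    exact absurd hlt (not_lt.2 (Finset.sum_nonneg hnn))
  rw [Set.indicator_of_mem hG, Pi.one_apply] at hlt
  have key : ∀ i j, par i = j → i ≠ j → G.Adj (f i) (f j) := by
    rintro i j rfl hij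
    have hi : i ≠ 0 := by
      rintro rfl
      exact hij h0.symm
    exact hG _ (mem_copyEdges.2 ⟨i, hi, rfl⟩)
  refine ⟨f, mem_placements.1 hf, fun i j => ⟨fun hij => ?_, fun hij => ?_⟩⟩
  · by_contra hn
    have hne : i ≠ j := fun e => hij.ne (by rw [e])
    have := Finset.single_le_sum hnn (Finset.mem_filter.2 ⟨Finset.mem_univ (i, j), hne, hn⟩)
    rw [Set.indicator_of_mem, Pi.one_apply] at this
    · exact absurd hlt (not_lt.2 this)
    · intro e he
      rcases Finset.mem_insert.1 he with rfl | he
      · exact hij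
      · exact hG e he
  · rcases hij.2 with h | h
    · exact key i j h hij.1
    · exact (key j i h hij.1.symm).symm

/-- Chebyshev's inequality for the copies and Markov's inequality for the copies with a further
edge. -/
theorem measureReal_no_induced_copy_le (n : ℕ) (p : I) (hp : 0 < (p : ℝ))
    (hpar : ∀ i, i ≠ 0 → par i < i) (h0 : par 0 = 0) (hn : 2 * (m + 1) ≤ n) :
    (SimpleGraph.binomialRandom (Fin n) p).real
      {G | ¬ ∃ f : Fin (m + 1) → Fin n, Function.Injective f ∧
        ∀ i j, G.Adj (f i) (f j) ↔ (parentGraph par).Adj i j} ≤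
      4 * (4 * (m + 1)) ^ (m + 1) / min (n : ℝ) (n * (n * p) ^ m) + 2 * (m + 1) ^ 2 * p := by
  set μ := SimpleGraph.binomialRandom (Fin n) p
  set E : ℝ := (placements n m).card * (p : ℝ) ^ m with hE
  have hn1 : (0 : ℝ) < n := by exact_mod_cast (by omega : 0 < n)
  have hE0 : 0 < E := by
    have : 0 < (placements n m).card := by
      rw [card_placements]
      exact Nat.descFactorial_pos.2 (by omega)
    positivity
  have hM0 : 0 < min (n : ℝ) (n * (n * p) ^ m) := lt_min hn1 (by positivity)
  have hsub : {G | ¬ ∃ f : Fin (m + 1) → Fin n, Function.Injective f ∧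
      ∀ i j, G.Adj (f i) (f j) ↔ (parentGraph par).Adj i j} ⊆
      {G | E / 2 ≤ |copyCount n par G - E|} ∪ {G | E / 2 ≤ chordCount n par G} := by
    intro G hG
    by_contra hn
    simp only [Set.mem_union, Set.mem_ofPred_eq, not_or, not_le] at hn
    obtain ⟨h1, h2⟩ := hn
    have := (abs_lt.1 h1).1
    exact hG (exists_induced_copy h0 (by linarith))
  refine (measureReal_mono hsub (measure_ne_top _ _)).trans ((measureReal_union_le _ _).trans ?_)
  refine add_le_add ?_ ?_
  · have h1 := meas_ge_le_variance_div_sq (μ := μ) (X := copyCount n par) MemLp.of_discrete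
      (half_pos hE0)
    rw [integral_copyCount n p hpar, ← hE] at h1
    have hv0 : 0 ≤ variance (copyCount n par) μ / (E / 2) ^ 2 :=
      div_nonneg (variance_nonneg _ _) (sq_nonneg _)
    have h2 : μ.real {G | E / 2 ≤ |copyCount n par G - E|} ≤
        variance (copyCount n par) μ / (E / 2) ^ 2 := by
      rw [measureReal_def]
      exact ENNReal.toReal_le_of_le_ofReal hv0 h1
    refine h2.trans ?_
    rw [div_le_div_iff₀ (by positivity) hM0]
    refine (variance_copyCount_mul_le n p hpar hn).trans_eq ?_
    rw [← hE]
    ring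
  · have h1 := mul_meas_ge_le_integral_of_nonneg (μ := μ) (f := chordCount n par)
      (ae_of_all _ fun G => chordCount_nonneg n G) Integrable.of_finite (E / 2)
    have h2 := h1.trans (integral_chordCount_le n p hpar)
    have h3 : ((placements n m).card : ℝ) * ((m + 1) ^ 2 * (p : ℝ) ^ (m + 1)) =
        E / 2 * (2 * (m + 1) ^ 2 * p) := by
      rw [hE]; ring
    rw [h3] at h2
    exact le_of_mul_le_mul_left h2 (half_pos hE0)

/-! ### Events of vanishing probability -/

theorem almostSurely_of_compl_le {p : ℕ → I} {A : ∀ n : ℕ, SimpleGraph (Fin n) → Prop} {b : ℕ → ℝ}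
    (hb : Tendsto b atTop (𝓝 0))
    (h : ∀ᶠ n in atTop,
      (SimpleGraph.binomialRandom (Fin n) (p n)).real {G | ¬ A n G} ≤ b n) :
    AlmostSurelyAsymptotically p A := by
  have h0 : Tendsto (fun n => (SimpleGraph.binomialRandom (Fin n) (p n)).real {G | ¬ A n G}) atTop
      (𝓝 0) :=
    tendsto_of_tendsto_of_tendsto_of_le_of_le' tendsto_const_nhds hb
      (Eventually.of_forall fun _ => measureReal_nonneg) h
  have h1 : Tendsto (fun n => (SimpleGraph.binomialRandom (Fin n) (p n)) {G | ¬ A n G}) atTop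
      (𝓝 0) := by
    have := (ENNReal.continuous_ofReal.tendsto 0).comp h0
    simpa [Function.comp_def, ofReal_measureReal] using this
  have h2 : Tendsto (fun n => 1 - (SimpleGraph.binomialRandom (Fin n) (p n)) {G | ¬ A n G}) atTop
      (𝓝 (1 - 0)) :=
    ENNReal.Tendsto.sub tendsto_const_nhds h1 (Or.inl ENNReal.one_ne_top)
  rw [tsub_zero] at h2
  refine h2.congr fun n => ?_
  rw [← prob_compl_eq_one_sub (Set.toFinite _).measurableSet]
  congr 1
  ext G
  simp

theorem AlmostSurelyAsymptotically.measureReal_compl {p : ℕ → I}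
    {A : ∀ n : ℕ, SimpleGraph (Fin n) → Prop} (h : AlmostSurelyAsymptotically p A) :
    Tendsto (fun n => (SimpleGraph.binomialRandom (Fin n) (p n)).real {G | ¬ A n G}) atTop
      (𝓝 0) := by
  have h2 : Tendsto (fun n => 1 - (SimpleGraph.binomialRandom (Fin n) (p n)) {G | A n G}) atTop
      (𝓝 (1 - 1)) :=
    ENNReal.Tendsto.sub tendsto_const_nhds h (Or.inl ENNReal.one_ne_top)
  rw [tsub_self] at h2
  have h3 := (ENNReal.tendsto_toReal ENNReal.zero_ne_top).comp h2
  rw [ENNReal.toReal_zero] at h3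
  refine h3.congr fun n => ?_
  rw [Function.comp_apply, ← prob_compl_eq_one_sub (Set.toFinite _).measurableSet, measureReal_def]
  rfl

theorem AlmostSurelyAsymptotically.and_imp {p : ℕ → I}
    {A A' B : ∀ n : ℕ, SimpleGraph (Fin n) → Prop} (h : AlmostSurelyAsymptotically p A)
    (h' : AlmostSurelyAsymptotically p A')
    (hB : ∀ᶠ n in atTop, ∀ G, A n G → A' n G → B n G) : AlmostSurelyAsymptotically p B := by
  have hlim := h.measureReal_compl.add h'.measureReal_compl
  rw [add_zero] at hlim
  refine almostSurely_of_compl_le hlim ?_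
  filter_upwards [hB] with n hn
  refine (measureReal_mono (fun G hG => ?_) (measure_ne_top _ _)).trans (measureReal_union_le _ _)
  by_contra hcon
  simp only [Set.mem_union, Set.mem_ofPred_eq, not_or, not_not] at hcon
  exact hG (hn G hcon.1 hcon.2)

theorem almostSurely_exists_induced_copy {m : ℕ} {par : Fin (m + 1) → Fin (m + 1)} {p : ℕ → I}
    (hpar : ∀ i, i ≠ 0 → par i < i) (h0 : par 0 = 0) (hp : ∀ᶠ n in atTop, 0 < (p n : ℝ))
    (hp0 : Tendsto (fun n => (p n : ℝ)) atTop (𝓝 0))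
    (hlim : Tendsto (fun n : ℕ => (n : ℝ) ^ (m + 1) * (p n : ℝ) ^ m) atTop atTop) :
    AlmostSurelyAsymptotically p fun n G => ∃ f : Fin (m + 1) → Fin n, Function.Injective f ∧
      ∀ i j, G.Adj (f i) (f j) ↔ (parentGraph par).Adj i j := by
  have hmin : Tendsto (fun n : ℕ => min (n : ℝ) (n * (n * p n) ^ m)) atTop atTop := by
    refine tendsto_atTop.2 fun b => ?_
    filter_upwards [tendsto_atTop.1 hlim b, tendsto_atTop.1 tendsto_natCast_atTop_atTop b]
      with n h1 h2
    refine le_min h2 (h1.trans_eq ?_)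
    ring
  have hb := (tendsto_const_nhds (x := (4 * (4 * ((m : ℝ) + 1)) ^ (m + 1)))).div_atTop hmin
  have hb' := hb.add (hp0.const_mul (2 * ((m : ℝ) + 1) ^ 2))
  rw [mul_zero, add_zero] at hb'
  refine almostSurely_of_compl_le hb' ?_
  filter_upwards [hp, eventually_ge_atTop (2 * (m + 1))] with n h1 h2
  exact measureReal_no_induced_copy_le n (p n) h1 hpar h0 h2

theorem almostSurely_omitsSubgraph {m : ℕ} {par : Fin (m + 1) → Fin (m + 1)} {p : ℕ → I}
    (hpar : ∀ i, i ≠ 0 → par i < i)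
    (hlim : Tendsto (fun n : ℕ => (n : ℝ) ^ (m + 1) * (p n : ℝ) ^ m) atTop (𝓝 0)) :
    AlmostSurelyAsymptotically p fun _ G => OmitsSubgraph G (parentGraph par) := by
  refine almostSurely_of_compl_le hlim (Eventually.of_forall fun n => ?_)
  have h := measureReal_exists_copy_le n (p n) (copyEdges par (id : Fin (m + 1) → Fin (m + 1)))
  rw [card_copyEdges Function.injective_id hpar] at h
  refine (measureReal_mono (fun G hG => ?_) (measure_ne_top _ _)).trans h
  by_contra hcon
  refine hG fun f hf hadj => hcon ⟨f, hf, fun e he => ?_⟩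
  obtain ⟨i, hi, rfl⟩ := mem_copyEdges.1 he
  exact hadj _ _ ⟨(hpar i hi).ne', Or.inl rfl⟩

/-! ### Cycles and bicycles -/

/-- The parent function of the path `0, 1, …, m`, rooted at `0`. -/
def predParent {m : ℕ} (i : Fin (m + 1)) : Fin (m + 1) := ⟨i - 1, by omega⟩

theorem predParent_lt {m : ℕ} (i : Fin (m + 1)) (hi : i ≠ 0) : predParent i < i := by
  have : (i : ℕ) ≠ 0 := fun h => hi (Fin.ext h)
  rw [Fin.lt_def, predParent]
  simp only
  omega

theorem mk_notMem_copyEdges_predParent {m : ℕ} {i j : Fin (m + 1)} (hij : (i : ℕ) + 2 ≤ j) :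
    s(i, j) ∉ copyEdges predParent (id : Fin (m + 1) → Fin (m + 1)) := by
  intro h
  obtain ⟨l, -, hl⟩ := mem_copyEdges.1 h
  rcases Sym2.eq_iff.1 hl with h | h <;>
  · have h1 := congrArg Fin.val h.1
    have h2 := congrArg Fin.val h.2
    simp only [id, predParent] at h1 h2
    omega

theorem IsPathSeq.mem_edgeSet {V : Type*} {G : SimpleGraph V} {m : ℕ} {f : Fin (m + 1) → V}
    (h : IsPathSeq G f) :
    ∀ e ∈ copyEdges predParent (id : Fin (m + 1) → Fin (m + 1)), Sym2.map f e ∈ G.edgeSet := by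
  intro e he
  obtain ⟨i, hi, rfl⟩ := mem_copyEdges.1 he
  refine (h.adj (predParent i) i ?_).symm
  have : (i : ℕ) ≠ 0 := fun h => hi (Fin.ext h)
  simp only [predParent]
  omega

theorem measureReal_not_cycleFree_le (n : ℕ) (p : I) :
    (SimpleGraph.binomialRandom (Fin n) p).real {G | ¬ CycleFree G} ≤
      ∑ k ∈ Finset.range n, ((n : ℝ) * p) ^ (k + 3) := by
  classical
  let E : ∀ k, Finset (Sym2 (Fin (k + 3))) := fun k =>
    insert s(0, Fin.last _) (copyEdges predParent id)
  have hE : ∀ k, (E k).card = k + 3 := fun k => by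
    rw [Finset.card_insert_of_notMem (mk_notMem_copyEdges_predParent (by simp)),
      card_copyEdges Function.injective_id predParent_lt]
  have hsub : {G : SimpleGraph (Fin n) | ¬ CycleFree G} ⊆ ⋃ k ∈ Finset.range n,
      {G | ∃ f : Fin (k + 3) → Fin n, Function.Injective f ∧
        ∀ e ∈ E k, Sym2.map f e ∈ G.edgeSet} := by
    intro G hG
    simp only [CycleFree, Set.mem_ofPred_eq, not_forall, not_not] at hG
    obtain ⟨k, f, hf, hadj⟩ := hG
    have hk : k + 3 ≤ n := by simpa using Fintype.card_le_of_injective f hf.inj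
    simp only [Set.mem_iUnion]
    refine ⟨k, Finset.mem_range.2 (by omega), f, hf.inj, fun e he => ?_⟩
    rcases Finset.mem_insert.1 he with rfl | he
    · exact hadj
    · exact hf.mem_edgeSet e he
  refine (measureReal_mono hsub (measure_ne_top _ _)).trans
    ((measureReal_biUnion_finset_le _ _).trans (Finset.sum_le_sum fun k _ => ?_))
  refine (measureReal_exists_copy_le n p (E k)).trans_eq ?_
  rw [hE, mul_pow]

theorem measureReal_not_noBicycle_le (n : ℕ) (p : I) :
    (SimpleGraph.binomialRandom (Fin n) p).real {G | ¬ NoBicycle G} ≤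
      p * ∑ k ∈ Finset.range n, ((k : ℝ) + 1) ^ 2 * ((n : ℝ) * p) ^ (k + 1) := by
  classical
  let Q : ∀ k, Finset (Fin (k + 1) × Fin (k + 1)) := fun k => {x | 2 ≤ (x.1 : ℕ) ∧
    (x.2 : ℕ) + 2 ≤ k ∧ ¬ ((x.1 : ℕ) = k ∧ (x.2 : ℕ) = 0)}
  let E : ∀ k, Fin (k + 1) × Fin (k + 1) → Finset (Sym2 (Fin (k + 1))) := fun k x =>
    insert s(0, x.1) (insert s(x.2, Fin.last k) (copyEdges predParent id))
  have hE : ∀ k, ∀ x ∈ Q k, (E k x).card = k + 2 := fun k x hx => by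
    obtain ⟨-, h1, h2, h3⟩ := Finset.mem_filter.1 hx
    rw [Finset.card_insert_of_notMem, Finset.card_insert_of_notMem
      (mk_notMem_copyEdges_predParent (by simpa using h2)),
      card_copyEdges Function.injective_id predParent_lt]
    intro h
    rcases Finset.mem_insert.1 h with h | h
    · rcases Sym2.eq_iff.1 h with h | h
      · exact h3 ⟨by simpa using congrArg Fin.val h.2, by simpa using congrArg Fin.val h.1.symm⟩
      · have := congrArg Fin.val h.1
        simp at this
        omega
    · exact mk_notMem_copyEdges_predParent (by simpa using h1) h
  have hsub : {G : SimpleGraph (Fin n) | ¬ NoBicycle G} ⊆ ⋃ k ∈ Finset.range n, ⋃ x ∈ Q k,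
      {G | ∃ f : Fin (k + 1) → Fin n, Function.Injective f ∧
        ∀ e ∈ E k x, Sym2.map f e ∈ G.edgeSet} := by
    intro G hG
    simp only [NoBicycle, Set.mem_ofPred_eq, not_forall] at hG
    obtain ⟨k, f, hf, i, j, hi, hj, h1, h2, hne⟩ := hG
    have hk : k + 1 ≤ n := by simpa using Fintype.card_le_of_injective f hf.inj
    simp only [Set.mem_iUnion]
    refine ⟨k, Finset.mem_range.2 (by omega), (i, j),
      Finset.mem_filter.2 ⟨Finset.mem_univ _, hi, hj, hne⟩, f, hf.inj, fun e he => ?_⟩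
    rcases Finset.mem_insert.1 he with rfl | he
    · exact h1
    · rcases Finset.mem_insert.1 he with rfl | he
      · exact h2.symm
      · exact hf.mem_edgeSet e he
  refine (measureReal_mono hsub (measure_ne_top _ _)).trans
    ((measureReal_biUnion_finset_le _ _).trans ?_)
  rw [Finset.mul_sum]
  refine Finset.sum_le_sum fun k _ => (measureReal_biUnion_finset_le _ _).trans ?_
  refine (Finset.sum_le_card_nsmul (Q k) _ ((n : ℝ) ^ (k + 1) * (p : ℝ) ^ (k + 2))
    fun x hx => ?_).trans ?_
  · refine (measureReal_exists_copy_le n p (E k x)).trans_eq ?_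
    rw [hE k x hx]
  · have hQ : ((Q k).card : ℝ) ≤ ((k : ℝ) + 1) ^ 2 := by
      have h := Finset.card_le_univ (Q k)
      rw [Fintype.card_prod, Fintype.card_fin, ← sq] at h
      exact_mod_cast h
    have hp0 : (0 : ℝ) ≤ p := p.2.1
    rw [nsmul_eq_mul]
    refine (mul_le_mul_of_nonneg_right hQ (by positivity)).trans_eq ?_
    rw [mul_pow]
    ring

theorem almostSurely_cycleFree {p : ℕ → I}
    (hlim : Tendsto (fun n : ℕ => (n : ℝ) * p n) atTop (𝓝 0)) :
    AlmostSurelyAsymptotically p fun _ G => CycleFree G := by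
  have hb : Tendsto (fun n : ℕ => ((n : ℝ) * p n) * 2) atTop (𝓝 0) := by
    simpa using hlim.mul_const 2
  refine almostSurely_of_compl_le hb ?_
  filter_upwards [hlim.eventually (ge_mem_nhds (show (0 : ℝ) < 1 / 2 by norm_num))] with n hn
  have ha : 0 ≤ (n : ℝ) * p n := mul_nonneg (Nat.cast_nonneg n) (p n).2.1
  refine (measureReal_not_cycleFree_le n (p n)).trans ?_
  set a := (n : ℝ) * p n
  have hgeom : ∑ k ∈ Finset.range n, (1 / 2 : ℝ) ^ k ≤ 2 := sum_geometric_two_le n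
  calc ∑ k ∈ Finset.range n, a ^ (k + 3) ≤ ∑ k ∈ Finset.range n, a * (1 / 2) ^ k := by
        refine Finset.sum_le_sum fun k _ => ?_
        rw [show k + 3 = k + 2 + 1 from rfl, pow_succ' a (k + 2)]
        refine mul_le_mul_of_nonneg_left ?_ ha
        exact (pow_le_pow_of_le_one ha (by linarith) (by omega)).trans
          (pow_le_pow_left₀ ha hn k)
    _ ≤ a * 2 := by
        rw [← Finset.mul_sum]
        exact mul_le_mul_of_nonneg_left hgeom ha

theorem almostSurely_noBicycle {p : ℕ → I} {c : ℝ} (hc0 : 0 < c) (hc1 : c < 1)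
    (hp : ∀ᶠ n : ℕ in atTop, (p n : ℝ) ≤ c / n)
    (hp0 : Tendsto (fun n => (p n : ℝ)) atTop (𝓝 0)) :
    AlmostSurelyAsymptotically p fun _ G => NoBicycle G := by
  have hs : Summable fun k : ℕ => ((k : ℝ) + 1) ^ 2 * c ^ (k + 1) := by
    have hc : ‖c‖ < 1 := by rwa [Real.norm_of_nonneg hc0.le]
    have := (summable_nat_add_iff (f := fun k : ℕ => (k : ℝ) ^ 2 * c ^ k) 1).2
      (summable_pow_mul_geometric_of_norm_lt_one 2 hc)
    exact this.congr fun k => by push_cast; rfl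
  have hb : Tendsto (fun n : ℕ => (p n : ℝ) * ∑' k : ℕ, ((k : ℝ) + 1) ^ 2 * c ^ (k + 1)) atTop
      (𝓝 0) := by
    simpa using hp0.mul_const (∑' k : ℕ, ((k : ℝ) + 1) ^ 2 * c ^ (k + 1))
  refine almostSurely_of_compl_le hb ?_
  filter_upwards [hp, eventually_gt_atTop 0] with n hn hn0
  have hpn : (0 : ℝ) ≤ p n := (p n).2.1
  have hn0' : (0 : ℝ) < n := by exact_mod_cast hn0
  have hnp : (n : ℝ) * p n ≤ c := by
    rw [le_div_iff₀ hn0'] at hn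
    linarith
  refine (measureReal_not_noBicycle_le n (p n)).trans (mul_le_mul_of_nonneg_left ?_ hpn)
  refine (Finset.sum_le_sum fun k _ => ?_).trans
    (hs.sum_le_tsum (Finset.range n) fun k _ => by positivity)
  gcongr

/-! ### Twin-width of random graphs -/

theorem twinWidth_le {V : Type*} [Fintype V] [DecidableEq V] {G : SimpleGraph V} {d : ℕ}
    (h : (Trigraph.ofGraph G).HasContractionSequence d) : twinWidth G ≤ d :=
  Nat.sInf_le h

theorem lt_twinWidth {V : Type*} [Fintype V] [DecidableEq V] [Nonempty V] {G : SimpleGraph V}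
    {m d : ℕ} {par : Fin (m + 1) → Fin (m + 1)}
    (hpar : ¬ (Trigraph.ofGraph (parentGraph par)).HasContractionSequence d)
    (h : ∃ f : Fin (m + 1) → V, Function.Injective f ∧
      ∀ i j, G.Adj (f i) (f j) ↔ (parentGraph par).Adj i j) : d < twinWidth G := by
  obtain ⟨f, hf, hadj⟩ := h
  by_contra hle
  exact hpar (((isLeast_twinWidth G).1.mono (not_lt.1 hle)).of_weaklyContains
    Finset.univ_nonempty (Trigraph.weaklyContains_ofGraph hf hadj))

theorem tendsto_mul_pow_zero {p : ℕ → I} {b : ℝ} {m : ℕ} (hm : m ≠ 0) (hb : b * m = m + 1)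
    (h : (fun n : ℕ => (p n : ℝ)) =o[atTop] fun n : ℕ => (n : ℝ) ^ (-b)) :
    Tendsto (fun n : ℕ => (n : ℝ) ^ (m + 1) * (p n : ℝ) ^ m) atTop (𝓝 0) := by
  have h1 := (h.tendsto_div_nhds_zero).pow m
  rw [zero_pow hm] at h1
  refine h1.congr' ?_
  filter_upwards [eventually_gt_atTop 0] with n hn
  have hn0 : (0 : ℝ) ≤ n := Nat.cast_nonneg n
  rw [Real.rpow_neg hn0, div_inv_eq_mul, mul_pow, ← Real.rpow_natCast ((n : ℝ) ^ b) m,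
    ← Real.rpow_mul hn0, hb, mul_comm]
  norm_cast

theorem eventually_pos_of_isLittleO {p : ℕ → I} {b : ℝ}
    (h : (fun n : ℕ => (n : ℝ) ^ (-b)) =o[atTop] fun n : ℕ => (p n : ℝ)) :
    ∀ᶠ n in atTop, 0 < (p n : ℝ) := by
  filter_upwards [h.bound one_pos, eventually_gt_atTop 0] with n hn hn0
  have hn0' : (0 : ℝ) < n := by exact_mod_cast hn0
  have h1 : 0 < ‖(n : ℝ) ^ (-b)‖ := norm_pos_iff.2 (Real.rpow_pos_of_pos hn0' _).ne'
  have h2 : 0 < ‖(p n : ℝ)‖ := by linarith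
  exact lt_of_le_of_ne (p n).2.1 (norm_pos_iff.1 h2).symm

theorem tendsto_mul_pow_atTop {p : ℕ → I} {b : ℝ} {m : ℕ} (hm : m ≠ 0) (hb : b * m = m + 1)
    (h : (fun n : ℕ => (n : ℝ) ^ (-b)) =o[atTop] fun n : ℕ => (p n : ℝ)) :
    Tendsto (fun n : ℕ => (n : ℝ) ^ (m + 1) * (p n : ℝ) ^ m) atTop atTop := by
  have hpos := eventually_pos_of_isLittleO h
  have h1 : Tendsto (fun n : ℕ => (n : ℝ) ^ (-b) / (p n : ℝ)) atTop (𝓝[>] 0) := by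
    refine tendsto_nhdsWithin_iff.2 ⟨h.tendsto_div_nhds_zero, ?_⟩
    filter_upwards [hpos, eventually_gt_atTop 0] with n hn hn0
    have hn0' : (0 : ℝ) < n := by exact_mod_cast hn0
    exact div_pos (Real.rpow_pos_of_pos hn0' _) hn
  have h2 := (tendsto_pow_atTop hm).comp h1.inv_tendsto_nhdsGT_zero
  refine h2.congr' ?_
  filter_upwards [eventually_gt_atTop 0] with n hn
  have hn0 : (0 : ℝ) ≤ n := Nat.cast_nonneg n
  rw [Function.comp_apply, Pi.inv_apply, inv_div, Real.rpow_neg hn0, div_inv_eq_mul, mul_pow,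
    ← Real.rpow_natCast ((n : ℝ) ^ b) m, ← Real.rpow_mul hn0, hb, mul_comm]
  norm_cast

end Probability

theorem theorem5 (p : ℕ → unitInterval) :
    ((fun n : ℕ => (p n : ℝ)) =o[atTop] (fun n : ℕ => (n : ℝ) ^ (-(4 / 3) : ℝ)) →
      AlmostSurelyAsymptotically p (fun _ G => twinWidth G = 0)) ∧
    ((fun n : ℕ => (n : ℝ) ^ (-(4 / 3) : ℝ)) =o[atTop] (fun n : ℕ => (p n : ℝ)) →
      (fun n : ℕ => (p n : ℝ)) =o[atTop] (fun n : ℕ => (n : ℝ) ^ (-(7 / 6) : ℝ)) →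
      AlmostSurelyAsymptotically p (fun _ G => twinWidth G = 1)) ∧
    (∀ c : ℝ, 0 < c → c < 1 →
      (fun n : ℕ => (n : ℝ) ^ (-(7 / 6) : ℝ)) =o[atTop] (fun n : ℕ => (p n : ℝ)) →
      (∀ᶠ n : ℕ in atTop, (p n : ℝ) ≤ c / (n : ℝ)) →
      AlmostSurelyAsymptotically p (fun _ G => twinWidth G = 2)) := by
  have hpath : ∀ i : Fin 4, i ≠ 0 → pathParent i < i := by decide
  have hspider : ∀ i : Fin 7, i ≠ 0 → spiderParent i < i := by decide
  refine ⟨fun h => ?_, fun h h' => ?_, fun c hc0 hc1 h hc => ?_⟩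
  · have h1 := almostSurely_omitsSubgraph hpath
      (tendsto_mul_pow_zero (m := 3) (by norm_num) (by norm_num) h)
    refine h1.and_imp h1 ?_
    filter_upwards [eventually_gt_atTop 0] with n hn G hG _
    have : Nonempty (Fin n) := ⟨⟨0, hn⟩⟩
    exact Nat.le_zero.1 (twinWidth_le (Trigraph.hasContractionSequence_zero
      Finset.univ_nonempty (fun _ _ h => h) hG))
  · have hnp : Tendsto (fun n : ℕ => (n : ℝ) * p n) atTop (𝓝 0) := by
      have h1 : Tendsto (fun n : ℕ => (n : ℝ) ^ (-(1 / 6) : ℝ)) atTop (𝓝 0) :=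
        (tendsto_rpow_neg_atTop (by norm_num)).comp tendsto_natCast_atTop_atTop
      have h2 := h'.tendsto_div_nhds_zero.mul h1
      rw [mul_zero] at h2
      refine h2.congr' ?_
      filter_upwards [eventually_gt_atTop 0] with n hn
      have hn0 : (0 : ℝ) < n := by exact_mod_cast hn
      rw [Real.rpow_neg hn0.le, div_inv_eq_mul, mul_assoc, ← Real.rpow_add hn0]
      norm_num
      ring
    have hp0 : Tendsto (fun n => (p n : ℝ)) atTop (𝓝 0) := by
      refine tendsto_of_tendsto_of_tendsto_of_le_of_le' tendsto_const_nhds hnp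
        (Eventually.of_forall fun n => (p n).2.1) ?_
      filter_upwards [eventually_ge_atTop 1] with n hn
      exact le_mul_of_one_le_left (p n).2.1 (by exact_mod_cast hn)
    have hlow := almostSurely_exists_induced_copy hpath rfl (eventually_pos_of_isLittleO h) hp0
      (tendsto_mul_pow_atTop (m := 3) (by norm_num) (by norm_num) h)
    have hup := (almostSurely_cycleFree hnp).and_imp (almostSurely_omitsSubgraph hspider
      (tendsto_mul_pow_zero (m := 6) (by norm_num) (by norm_num) h'))
      (B := fun _ G => CycleFree G ∧ OmitsSubgraph G (parentGraph spiderParent))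
      (Eventually.of_forall fun _ _ h1 h2 => ⟨h1, h2⟩)
    refine hup.and_imp hlow ?_
    filter_upwards [eventually_gt_atTop 0] with n hn G hG hcopy
    have : Nonempty (Fin n) := ⟨⟨0, hn⟩⟩
    exact le_antisymm (twinWidth_le (Trigraph.hasContractionSequence_one hG.1 hG.2))
      (lt_twinWidth Trigraph.not_hasContractionSequence_path hcopy)
  · have hp0 : Tendsto (fun n => (p n : ℝ)) atTop (𝓝 0) :=
      tendsto_of_tendsto_of_tendsto_of_le_of_le' tendsto_const_nhds
        (tendsto_const_nhds.div_atTop tendsto_natCast_atTop_atTop)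
        (Eventually.of_forall fun n => (p n).2.1) hc
    have hlow := almostSurely_exists_induced_copy hspider rfl (eventually_pos_of_isLittleO h) hp0
      (tendsto_mul_pow_atTop (m := 6) (by norm_num) (by norm_num) h)
    refine (almostSurely_noBicycle hc0 hc1 hc hp0).and_imp hlow ?_
    filter_upwards [eventually_gt_atTop 0] with n hn G hG hcopy
    have : Nonempty (Fin n) := ⟨⟨0, hn⟩⟩
    exact le_antisymm (twinWidth_le (Trigraph.hasContractionSequence_two hG))
      (lt_twinWidth Trigraph.not_hasContractionSequence_spider hcopy)
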